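/- Setting. There are $n\ge 2$ boxes; the quality of each is independently $1$ with probability $\mu$ and $0$ with probability $1-\mu$, where $\mu\in(0,1)$. A pure strategy of a box is a distribution in $M(\mu)$, the set of Borel probability distributions on $[0,1]$ with mean $\mu$ (the distributions of the posterior mean induced by signals about its quality). A searcher observes the chosen distributions $F_1,\dots,F_n$ and then searches sequentially: opening box $i$ costs $c\ge 0$, delays all later payoffs by one period, discounted by $\beta\in(0,1]$, and reveals an independent draw $x_i\sim F_i$; she may stop at any time and take one opened box, which is worth $x_i$ to her, or an outside option worth $0$. Assume $\beta\mu>c$, and that there are frictions: $c>0$ or $\beta<1$. The reservation value $z_F$ of $F\in M(\mu)$ is the unique solution of $z=-c+\beta\int\max(z,x)\,dF(x)$. For every profile of distributions the searcher uses a policy that maximizes her expected discounted utility and is fair: at every history, the closed boxes with the highest reservation value among the closed boxes are equally likely to be visited next; the opened boxes with the highest value seen are equally likely to be selected; and an opened box of value at least $0$ is never passed over for the outside option. When the highest value seen equals the highest reservation value of a closed box, she may stop or continue in any way. The payoff of a box is the probability that it is selected. A symmetric equilibrium in pure strategies consists of such an optimal fair response of the searcher to every profile and an $F\in M(\mu)$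 such that, when all boxes choose $F$, no box can increase its payoff by choosing another element of $M(\mu)$. Theorem. Suppose that $\mu<1-(1/n)^{1/(n-1)}$. Then there is no symmetric equilibrium in pure strategies. Moreover, for every optimal fair response of the searcher: (i) Let $F\in M(\mu)$ be such that $z_F$ is not maximal, i.e. $z_F<z_H$ for some $H\in M(\mu)$. Then for every $\varepsilon>0$ there is a $G\in M(\mu)$ that is a mean-preserving spread of $F$ (more informative than $F$), with $|G(A)-F(A)|<\varepsilon$ for all Borel sets $A$ and $z_F<z_G<z_F+\varepsilon$, such that any box that deviates to $G$ when all the others choose $F$ gets a payoff greater than $1/n$, and for at least one box this is a strict improvement on its payoff when all boxes choose $F$. (ii) If all boxes choose the fully informative distribution (value $1$ with probability $\mu$, value $0$ with probability $1-\mu$), then every box strictly increases its payoff by deviating to the uninformative distribution (the point mass at $\mu$). -/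

import Mathlib

open MeasureTheory Set

noncomputable section

namespace PandoraGame

/-- The set `M(μ)` of pure strategies of a box: all Borel probability distributions on `[0,1]`
with mean `μ` (the distributions of the posterior mean that a signal about a Bernoulli(`μ`)
quality can induce). -/
structure Strategy (μ : ℝ) where
  law : Measure ℝ
  isProb : IsProbabilityMeasure law
  support : law (Icc 0 1)ᶜ = 0
  mean : ∫ x, x ∂law = μ

attribute [instance] Strategy.isProb

/-- The fully revealing signal: the posterior mean is `1` with probability `μ` and `0` with
probability `1 - μ`. It is the prior itself. -/
def fullyRevealing (μ : ℝ) (h0 : 0 ≤ μ) (h1 : μ ≤ 1) : Strategy μ where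
  law := ENNReal.ofReal (1 - μ) • Measure.dirac 0 + ENNReal.ofReal μ • Measure.dirac 1
  isProb := by
    constructor
    have h : ENNReal.ofReal (1 - μ) + ENNReal.ofReal μ = 1 := by
      rw [← ENNReal.ofReal_add (by linarith) h0]; simp
    simpa using h
  support := by simp
  mean := by
    rw [integral_add_measure]
    · simp [h0]
    · exact (integrable_dirac (by simp)).smul_measure (by simp)
    · exact (integrable_dirac (by simp)).smul_measure (by simp)

/-- The uninformative signal: the posterior mean is always the prior mean. -/
def uninformative (μ : ℝ) (h0 : 0 ≤ μ) (h1 : μ ≤ 1) : Strategy μ where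
  law := Measure.dirac μ
  isProb := inferInstance
  support := by simp [h0, h1]
  mean := by simp

/-- `G` is at least as informative as `F` (Blackwell): `G` is a mean-preserving spread
of `F`, i.e. larger in the convex order. -/
def MoreInformative {μ : ℝ} (G F : Strategy μ) : Prop :=
  ∀ f : ℝ → ℝ, ConvexOn ℝ univ f → ∫ x, f x ∂F.law ≤ ∫ x, f x ∂G.law

/-- The equation of the reservation price: `z = -c + β (∫_{x ≤ z} z dF + ∫_{x > z} x dF)`. -/
def IsReservationValue {μ : ℝ} (c β : ℝ) (F : Strategy μ) (z : ℝ) : Prop :=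
  z = -c + β * ∫ x, max z x ∂F.law

theorem Strategy.ae_mem {μ : ℝ} (F : Strategy μ) : ∀ᵐ x ∂F.law, x ∈ Icc (0 : ℝ) 1 := by
  rw [ae_iff]; exact F.support

theorem Strategy.integrable_id {μ : ℝ} (F : Strategy μ) :
    Integrable (fun x : ℝ => x) F.law := by
  refine Integrable.of_bound (by fun_prop) 1 ?_
  filter_upwards [F.ae_mem] with x hx
  rw [Real.norm_eq_abs, abs_of_nonneg hx.1]; exact hx.2

theorem Strategy.integrable_max {μ : ℝ} (F : Strategy μ) (z : ℝ) :
    Integrable (fun x : ℝ => max z x) F.law :=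
  (integrable_const z).sup F.integrable_id

/-- With frictions the reservation price exists and is unique. -/
theorem existsUnique_isReservationValue {μ c β : ℝ} (hβ0 : 0 < β) (hβ1 : β ≤ 1)
    (hc : 0 ≤ c) (hs : c < β * μ) (hf : 0 < c ∨ β < 1) (F : Strategy μ) :
    ∃! z, IsReservationValue c β F z := by
  have hmono : ∀ z z' : ℝ, z ≤ z' → ∫ x, max z' x ∂F.law ≤ (∫ x, max z x ∂F.law) + (z' - z) := by
    intro z z' h
    have e : (∫ x, max z x ∂F.law) + (z' - z) = ∫ x, (max z x + (z' - z)) ∂F.law := by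
      rw [integral_add (F.integrable_max z) (integrable_const _)]; simp
    rw [e]
    refine integral_mono (F.integrable_max z') ((F.integrable_max z).add (integrable_const _)) ?_
    intro x
    show max z' x ≤ max z x + (z' - z)
    rcases max_cases z' x with h1 | h1 <;> rcases max_cases z x with h2 | h2 <;> linarith
  have hmono' : ∀ z z' : ℝ, z ≤ z' → ∫ x, max z x ∂F.law ≤ ∫ x, max z' x ∂F.law := by
    intro z z' h
    exact integral_mono (F.integrable_max z) (F.integrable_max z')
      (fun x => max_le_max_right x h)
  have hlip : LipschitzWith 1 (fun z : ℝ => ∫ x, max z x ∂F.law) := by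
    refine LipschitzWith.of_le_add fun a b => ?_
    rw [Real.dist_eq]
    rcases le_total a b with h | h
    · have := hmono' a b h
      have := abs_nonneg (a - b)
      linarith
    · have := hmono b a h
      have := le_abs_self (a - b)
      linarith
  have key : ∀ z z' : ℝ, z < z' → IsReservationValue c β F z → ¬ IsReservationValue c β F z' := by
    intro z z' hlt hz hz'
    unfold IsReservationValue at hz hz'
    have h1 := hmono z z' hlt.le
    have hβ : β = 1 := by
      by_contra hne
      have hb : β < 1 := lt_of_le_of_ne hβ1 hne
      have : β * ∫ x, max z' x ∂F.law ≤ β * ((∫ x, max z x ∂F.law) + (z' - z)) :=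
        mul_le_mul_of_nonneg_left h1 hβ0.le
      nlinarith
    subst hβ
    have hc' : 0 < c := by rcases hf with h | h; exacts [h, absurd h (lt_irrefl _)]
    have hint : Integrable (fun x => (z' - z) - (max z' x - max z x)) F.law :=
      (integrable_const _).sub ((F.integrable_max z').sub (F.integrable_max z))
    have hzero : ∫ x, ((z' - z) - (max z' x - max z x)) ∂F.law = 0 := by
      have e1 : ∫ x, (max z' x - max z x) ∂F.law
          = (∫ x, max z' x ∂F.law) - ∫ x, max z x ∂F.law :=
        integral_sub (F.integrable_max z') (F.integrable_max z)
      have e2 : ∫ x, ((z' - z) - (max z' x - max z x)) ∂F.law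
          = (∫ _, (z' - z) ∂F.law) - ∫ x, (max z' x - max z x) ∂F.law :=
        integral_sub (integrable_const _) ((F.integrable_max z').sub (F.integrable_max z))
      rw [e2, e1]
      simp only [integral_const, probReal_univ, one_smul]
      linarith
    rw [integral_eq_zero_iff_of_nonneg _ hint] at hzero
    · have hle : ∀ᵐ x ∂F.law, max z x = z := by
        filter_upwards [hzero] with x hx
        simp only [Pi.zero_apply] at hx
        rcases max_cases z' x with h1 | h1 <;> rcases max_cases z x with h2 | h2 <;> linarith
      rw [integral_congr_ae hle] at hz
      simp at hz; linarith
    · intro x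
      show 0 ≤ (z' - z) - (max z' x - max z x)
      rcases max_cases z' x with h1 | h1 <;> rcases max_cases z x with h2 | h2 <;> linarith
  have hcont : ContinuousOn (fun z : ℝ => -c + β * (∫ x, max z x ∂F.law) - z) (Icc 0 1) := by
    have := hlip.continuous
    fun_prop
  have h0 : ∫ x, max 0 x ∂F.law = μ := by
    refine Eq.trans (integral_congr_ae ?_) F.mean
    filter_upwards [F.ae_mem] with x hx using max_eq_right hx.1
  have h1 : ∫ x, max 1 x ∂F.law = 1 := by
    have : ∀ᵐ x ∂F.law, max 1 x = 1 := by
      filter_upwards [F.ae_mem] with x hx using max_eq_left hx.2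
    rw [integral_congr_ae this]; simp
  obtain ⟨z, -, hz⟩ := intermediate_value_Icc' (zero_le_one) hcont
    (show (0 : ℝ) ∈ Icc _ _ by
      refine ⟨?_, ?_⟩
      · simp only [h1]; rcases hf with h | h <;> linarith
      · simp only [h0]; linarith)
  refine ⟨z, ?_, ?_⟩
  · simp only at hz; show z = _; linarith
  · intro y hy
    have hz' : IsReservationValue c β F z := by simp only at hz; show z = _; linarith
    rcases lt_trichotomy y z with h | h | h
    · exact absurd hz' (key y z h hy)
    · exact h
    · exact absurd hy (key z y h hz')

/-- The reservation price `z_F` (the unique solution of its defining equation). -/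
def reservationValue {μ : ℝ} (c β : ℝ) (F : Strategy μ) : ℝ :=
  Classical.epsilon (IsReservationValue c β F)

/-- A (behavioural, possibly randomized) policy of Pandora with `n` boxes.

A history is the list `l` of the boxes opened so far (most recent first) together with the values
seen in them; `x` is the vector of all the values, of which the policy may use only the coordinates
in `l`. An action is an element of `Option (Fin n)`: `none` is to stop and take the outside option;
`some i` is to stop and take box `i` if `i` is already open, and to open box `i` if it is closed.
`prob l x a` is the probability of the action `a` at the history. -/
structure Policy (n : ℕ) where
  prob : List (Fin n) → (Fin n → ℝ) → Option (Fin n) → ℝ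
  nonneg : ∀ l x a, 0 ≤ prob l x a
  sum_eq_one : ∀ l x, ∑ a, prob l x a = 1
  measurable : ∀ l a, Measurable fun x => prob l x a
  adapted : ∀ l x y, (∀ i ∈ l, x i = y i) → prob l x = prob l y

variable {n : ℕ}

/-- Pandora's expected continuation utility from the history `l` when the values in the boxes are
`x`, with at most `k` further openings: the outside option is worth `0`, an open box `i` is worth
`x i`, and opening a box costs `c` at once and delays everything else by a period, discounted
by `β`. -/
def Policy.utilityFrom (p : Policy n) (c β : ℝ) (x : Fin n → ℝ) : ℕ → List (Fin n) → ℝ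
  | 0, l => ∑ i, if i ∈ l then p.prob l x (some i) * x i else 0
  | k + 1, l => ∑ i, if i ∈ l then p.prob l x (some i) * x i
      else p.prob l x (some i) * (-c + β * Policy.utilityFrom p c β x k (i :: l))

/-- The probability that box `j` is finally selected, from the history `l`, when the values in the
boxes are `x`, with at most `k` further openings. -/
def Policy.selectFrom (p : Policy n) (j : Fin n) (x : Fin n → ℝ) : ℕ → List (Fin n) → ℝ
  | 0, l => ∑ i, if i ∈ l then p.prob l x (some i) * (if i = j then 1 else 0) else 0
  | k + 1, l => ∑ i, if i ∈ l then p.prob l x (some i) * (if i = j then 1 else 0)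
      else p.prob l x (some i) * Policy.selectFrom p j x k (i :: l)

variable {μ : ℝ}

/-- Pandora's expected discounted utility; the values are independent with laws `σ i`. -/
def pandoraUtility (c β : ℝ) (σ : Fin n → Strategy μ) (p : Policy n) : ℝ :=
  ∫ x, p.utilityFrom c β x n [] ∂(Measure.pi fun i => (σ i).law)

/-- The payoff of box `j`: the probability that Pandora selects it. -/
def boxPayoff (σ : Fin n → Strategy μ) (p : Policy n) (j : Fin n) : ℝ :=
  ∫ x, p.selectFrom j x n [] ∂(Measure.pi fun i => (σ i).law)

/-- The policy is optimal for Pandora among all policies, given the strategies of the boxes. -/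
def IsOptimal (c β : ℝ) (σ : Fin n → Strategy μ) (p : Policy n) : Prop :=
  ∀ q : Policy n, pandoraUtility c β σ q ≤ pandoraUtility c β σ p

/-- `U*`: the closed boxes whose reservation value is maximal among the closed boxes. -/
def maxClosed (c β : ℝ) (σ : Fin n → Strategy μ) (l : List (Fin n)) : Set (Fin n) :=
  {i | i ∉ l ∧ ∀ j, j ∉ l → reservationValue c β (σ j) ≤ reservationValue c β (σ i)}

/-- `O*`: the open boxes whose value equals the largest of the values seen and the outside
option `0`. -/
def maxOpen (x : Fin n → ℝ) (l : List (Fin n)) : Set (Fin n) :=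
  {i | i ∈ l ∧ 0 ≤ x i ∧ ∀ j ∈ l, x j ≤ x i}

/-- A fair policy: the members of `U*` are equally likely to be visited next, the members of `O*`
are equally likely to be selected, and when `O*` is nonempty the outside option is not taken in
place of a box that is at least as good (so that the payoffs of the boxes add up to `1`). -/
structure IsFair (c β : ℝ) (σ : Fin n → Strategy μ) (p : Policy n) : Prop where
  visit : ∀ l x, ∀ i ∈ maxClosed c β σ l, ∀ j ∈ maxClosed c β σ l,
    p.prob l x (some i) = p.prob l x (some j)
  select : ∀ l x, ∀ i ∈ maxOpen x l, ∀ j ∈ maxOpen x l,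
    p.prob l x (some i) = p.prob l x (some j)
  outside : ∀ l x, (maxOpen x l).Nonempty → p.prob l x none = 0

/-- Pandora responds to every profile of distributions with a fair optimal policy. -/
def IsFairOptimalResponse (c β : ℝ) (η : (Fin n → Strategy μ) → Policy n) : Prop :=
  ∀ σ, IsOptimal c β σ (η σ) ∧ IsFair c β σ (η σ)

/-- A fair subgame perfect equilibrium in which the boxes use the pure strategies `σ`. -/
def IsFSPE (c β : ℝ) (η : (Fin n → Strategy μ) → Policy n) (σ : Fin n → Strategy μ) : Prop :=
  IsFairOptimalResponse c β η ∧
    ∀ (i : Fin n) (F : Strategy μ),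
      boxPayoff (Function.update σ i F) (η (Function.update σ i F)) i ≤ boxPayoff σ (η σ) i

end PandoraGame

end

open PandoraGame

/-! The proof needs to know what an optimal searcher does almost surely, and this comes from a
pathwise form of Weitzman's theorem. The cost `-c` of opening a box is replaced by `openingReward`,
a function of the value inside with mean `-c`. The decision to open a box is independent of its
content, so expected utility does not change (`pandoraUtility_eq_amended`). With the amended
rewards, the utility of any policy is at most `indexValue` at every realization in the unit cube
(`Policy.amendedFrom_le`), and Weitzman's rule attains this bound (`weitzmanPolicy_amendedFrom`).
Hence an optimal policy attains it almost surely and incurs no loss at the histories it reaches.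
Some wrong actions are losses only if closed boxes turn out well; independence shows that these too
are almost never taken. The outcome is `IsOptimal.ae_regular`.

For (i), mixing `F` with a small weight `t` of full revelation raises a non-maximal reservation
value, so the deviator is visited first. Let `a` be the mass of `F` above `z_F`, positive because of
the frictions. The deviator is selected whenever its value exceeds `z_F`, and it gets a fair share
of the event that no value does. Its payoff is therefore at least `(1 - t) * (a + (1 - a) ^ n / n)`
(`le_boxPayoff_update`), which exceeds `1 / n` for small `t` by Bernoulli's inequality. Payoffs sum
to at most `1`, so under the common `F` some box has at most `1 / n`.

For (ii), fairness gives each fully revealing box at most `1 / n`, whereas an uninformative deviator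
is selected whenever all others show `0`, an event of probability `(1 - μ) ^ (n - 1)`. The
hypothesis on `μ` says exactly that this exceeds `1 / n`.

There is no equilibrium because the two parts cover every `F`: reservation values lie strictly
between `0` and `1`, so only full revelation has the maximal one (`Strategy.eq_fullyRevealing`). -/

open ProbabilityTheory

namespace PandoraGame

/-! ### Product measures: symmetry, independence, mixtures in one factor -/

section ProductMeasure

variable {ι : Type*} [Fintype ι]

/-- Permuting the coordinates does not change an integral over a power of a measure. -/
theorem integral_pi_comp_perm (ν : Measure ℝ) [IsProbabilityMeasure ν] (e : Equiv.Perm ι)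
    (f : (ι → ℝ) → ℝ) :
    ∫ x, f (x ∘ e) ∂(Measure.pi fun _ : ι => ν) = ∫ x, f x ∂(Measure.pi fun _ : ι => ν) := by
  have h := measurePreserving_piCongrLeft (fun _ : ι => ν) e.symm
  have h2 := h.integral_comp (MeasurableEquiv.measurableEmbedding _) f
  rw [← h2]
  refine integral_congr_ae (Filter.Eventually.of_forall fun x => ?_)
  show f _ = f _
  congr 1
  funext i
  obtain ⟨j, rfl⟩ := e.symm.surjective i
  erw [Equiv.piCongrLeft_apply_apply]
  simp

variable [DecidableEq ι]

/-- Functions of disjoint sets of coordinates are independent under a product measure. -/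
theorem integral_pi_mul_of_disjoint (ν : ι → Measure ℝ) [∀ i, IsProbabilityMeasure (ν i)]
    (s t : Finset ι) (hst : Disjoint s t) (f g : (ι → ℝ) → ℝ) (hf : Measurable f)
    (hg : Measurable g) (hfs : ∀ x y, (∀ i ∈ s, x i = y i) → f x = f y)
    (hgt : ∀ x y, (∀ i ∈ t, x i = y i) → g x = g y) :
    ∫ x, f x * g x ∂(Measure.pi ν) = (∫ x, f x ∂(Measure.pi ν)) * ∫ x, g x ∂(Measure.pi ν) := by
  -- Filling in `0` off `s` and off `t` turns `f` and `g` into functions of the two blocks of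
  -- coordinates alone, to which independence of the blocks applies.
  have hext : ∀ u : Finset ι,
      Measurable fun (w : u → ℝ) (i : ι) => if h : i ∈ u then w ⟨i, h⟩ else 0 := by
    intro u
    refine measurable_pi_lambda _ fun i => ?_
    by_cases h : i ∈ u
    · simpa [h] using measurable_pi_apply (⟨i, h⟩ : u)
    · simp [h]
  have hI := (iIndepFun_pi (μ := ν) (X := fun _ x => x)
    (fun i => measurable_id.aemeasurable)).indepFun_finset s t hst
    (fun i => measurable_pi_apply i)
  have hc := hI.comp (hf.comp (hext s)) (hg.comp (hext t))
  have e1 : (f ∘ fun (w : s → ℝ) (i : ι) => if h : i ∈ s then w ⟨i, h⟩ else 0) ∘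
      (fun (a : ι → ℝ) (i : s) => a i) = f := by
    funext x
    exact hfs _ _ fun i hi => by simp [hi]
  have e2 : (g ∘ fun (w : t → ℝ) (i : ι) => if h : i ∈ t then w ⟨i, h⟩ else 0) ∘
      (fun (a : ι → ℝ) (i : t) => a i) = g := by
    funext x
    exact hgt _ _ fun i hi => by simp [hi]
  rw [e1, e2] at hc
  exact hc.integral_fun_mul_eq_mul_integral hf.aestronglyMeasurable hg.aestronglyMeasurable

/-- A nonnegative function that vanishes on an independent event of positive probability
vanishes almost everywhere. -/
theorem ae_eq_zero_of_independent_event (ν : ι → Measure ℝ) [∀ i, IsProbabilityMeasure (ν i)]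
    (s : Finset ι) (f : (ι → ℝ) → ℝ) (hf : Measurable f) (h0 : ∀ x, 0 ≤ f x)
    (hfi : Integrable f (Measure.pi ν))
    (hfs : ∀ x y, (∀ i ∈ s, x i = y i) → f x = f y)
    (B : ι → Set ℝ) (hB : ∀ i, MeasurableSet (B i)) (hpos : ∀ i, 0 < ν i (B i))
    (h : ∀ᵐ x ∂(Measure.pi ν), (∀ i, i ∉ s → x i ∈ B i) → f x = 0) :
    ∀ᵐ x ∂(Measure.pi ν), f x = 0 := by
  set E : Set (ι → ℝ) := {x | ∀ i, i ∉ s → x i ∈ B i} with hE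
  have hEm : MeasurableSet E := by
    have : E = ⋂ i, ⋂ (_ : i ∉ s), (fun x : ι → ℝ => x i) ⁻¹' B i := by
      ext x; simp [hE]
    rw [this]
    exact MeasurableSet.iInter fun i => MeasurableSet.iInter fun _ => measurable_pi_apply i (hB i)
  have hEpos : 0 < (Measure.pi ν).real E := by
    have h1 : 0 < Measure.pi ν (Set.univ.pi B) := by
      rw [Measure.pi_pi]
      exact pos_iff_ne_zero.2 (Finset.prod_ne_zero_iff.2 fun i _ => (hpos i).ne')
    refine ENNReal.toReal_pos (lt_of_lt_of_le h1 (measure_mono (show Set.univ.pi B ⊆ E from fun x hx i _ => hx i trivial))).ne'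
      (measure_ne_top _ _)
  have key := integral_pi_mul_of_disjoint ν s sᶜ disjoint_compl_right f (E.indicator 1) hf
    (measurable_one.indicator hEm) hfs (by
      intro x y hxy
      have : x ∈ E ↔ y ∈ E := by
        refine forall_congr' fun i => forall_congr' fun hi => ?_
        rw [hxy i (by simpa using hi)]
      by_cases hx : x ∈ E
      · rw [indicator_of_mem hx, indicator_of_mem (this.1 hx)]; rfl
      · rw [indicator_of_notMem hx, indicator_of_notMem (fun hy => hx (this.2 hy))])
  have hz : ∫ x, f x * E.indicator 1 x ∂(Measure.pi ν) = 0 := by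
    refine integral_eq_zero_of_ae ?_
    filter_upwards [h] with x hx
    by_cases hxE : x ∈ E
    · simp [hx hxE]
    · simp [hxE]
  rw [hz, integral_indicator_one hEm] at key
  have : ∫ x, f x ∂(Measure.pi ν) = 0 := by
    rcases mul_eq_zero.1 key.symm with h | h
    · exact h
    · exact absurd h hEpos.ne'
  exact (integral_eq_zero_iff_of_nonneg h0 hfi).1 this

/-- A product measure dominates the part coming from one component of a mixture in one
coordinate. -/
theorem integral_pi_update_ge (ν : ι → Measure ℝ) [∀ i, IsProbabilityMeasure (ν i)]
    (i : ι) (ρ κ : Measure ℝ) [IsProbabilityMeasure ρ] [IsProbabilityMeasure κ] (t : ℝ)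
    (ht0 : 0 ≤ t) (ht1 : t ≤ 1)
    (hρ : ρ = ENNReal.ofReal (1 - t) • ν i + ENNReal.ofReal t • κ)
    (f : (ι → ℝ) → ℝ) (hf : Measurable f) (h0 : ∀ x, 0 ≤ f x) (h1 : ∀ x, f x ≤ 1)
    (ν' : ι → Measure ℝ) [∀ i, IsProbabilityMeasure (ν' i)] (hν' : ν' = Function.update ν i ρ) :
    (1 - t) * ∫ x, f x ∂(Measure.pi ν) ≤ ∫ x, f x ∂(Measure.pi ν') := by
  -- A product measure is affine in its `i`-th factor, so `Measure.pi ν'` is a mixture of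
  -- `Measure.pi ν` and `Measure.pi ν''`; the second part contributes a nonnegative integral and is
  -- dropped.
  set ν'' := Function.update ν i κ with hν''
  have : ∀ j, IsProbabilityMeasure (ν'' j) := by
    intro j
    by_cases h : j = i
    · subst h; simpa [hν''] using ‹IsProbabilityMeasure κ›
    · simpa [hν'', h] using ‹∀ i, IsProbabilityMeasure (ν i)› j
  have hpi : Measure.pi ν' = ENNReal.ofReal (1 - t) • Measure.pi ν
      + ENNReal.ofReal t • Measure.pi ν'' := by
    refine Measure.pi_eq fun s hs => ?_
    have hsplit : ∀ m : ι → Measure ℝ, ∏ j, m j (s j) = m i (s i) *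
        ∏ j ∈ Finset.univ.erase i, m j (s j) := fun m =>
      (Finset.mul_prod_erase Finset.univ (fun j => m j (s j)) (Finset.mem_univ i)).symm
    have hrest : ∀ m : Measure ℝ, ∏ j ∈ Finset.univ.erase i, (Function.update ν i m) j (s j)
        = ∏ j ∈ Finset.univ.erase i, ν j (s j) := fun m =>
      Finset.prod_congr rfl fun j hj => by rw [Function.update_of_ne (Finset.ne_of_mem_erase hj)]
    simp only [Measure.add_apply, Measure.smul_apply, Measure.pi_pi, smul_eq_mul]
    rw [hsplit ν', hsplit ν, hsplit ν'', hν', hν'', hrest, hrest]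
    simp only [Function.update_self]
    rw [hρ]
    simp only [Measure.add_apply, Measure.smul_apply, smul_eq_mul]
    ring
  have hint : ∀ m : Measure (ι → ℝ), IsProbabilityMeasure m → Integrable f m := fun m _ =>
    Integrable.of_bound hf.aestronglyMeasurable 1 (Filter.Eventually.of_forall fun x => by
      rw [Real.norm_eq_abs, abs_of_nonneg (h0 x)]; exact h1 x)
  rw [hpi, integral_add_measure ((hint _ inferInstance).smul_measure (by simp))
    ((hint _ inferInstance).smul_measure (by simp)), integral_smul_measure, integral_smul_measure,
    ENNReal.toReal_ofReal (by linarith), ENNReal.toReal_ofReal ht0]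
  have : 0 ≤ ∫ x, f x ∂(Measure.pi ν'') := integral_nonneg h0
  simp only [smul_eq_mul]
  nlinarith [mul_nonneg ht0 this]

end ProductMeasure

/-- A bounded nonnegative function that is positive on a subinterval of `[0, 1)` has positive
integral. -/
theorem setIntegral_Ico_pos {g : ℝ → ℝ} (hg : Integrable g (volume.restrict (Ico (0 : ℝ) 1)))
    (h0 : ∀ y, 0 ≤ g y) {a b : ℝ} (ha : 0 ≤ a) (hab : a < b) (hb : b ≤ 1)
    (hpos : ∀ y, a < y → y < b → 0 < g y) : 0 < ∫ y in Ico (0 : ℝ) 1, g y := by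
  rw [integral_pos_iff_support_of_nonneg h0 hg]
  have h : Ioo a b ⊆ Function.support g := fun y hy => (hpos y hy.1 hy.2).ne'
  refine lt_of_lt_of_le ?_ (measure_mono h)
  rw [Measure.restrict_apply measurableSet_Ioo,
    inter_eq_left.2 (show Ioo a b ⊆ Ico 0 1 from
      fun y hy => ⟨ha.trans hy.1.le, hy.2.trans_le hb⟩)]
  simpa using hab

variable {μ : ℝ}

/-! ### Reservation values -/

section ReservationValue

variable {c β : ℝ}

theorem reservationValue_spec (hβ0 : 0 < β) (hβ1 : β ≤ 1) (hc : 0 ≤ c) (hs : c < β * μ)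
    (hf : 0 < c ∨ β < 1) (F : Strategy μ) :
    reservationValue c β F = -c + β * ∫ x, max (reservationValue c β F) x ∂F.law :=
  Classical.epsilon_spec (p := IsReservationValue c β F)
    (existsUnique_isReservationValue hβ0 hβ1 hc hs hf F).exists

theorem Strategy.integral_max_le_add (F : Strategy μ) {z z' : ℝ} (h : z ≤ z') :
    ∫ x, max z' x ∂F.law ≤ (∫ x, max z x ∂F.law) + (z' - z) := by
  have e : (∫ x, max z x ∂F.law) + (z' - z) = ∫ x, (max z x + (z' - z)) ∂F.law := by
    rw [integral_add (F.integrable_max z) (integrable_const _)]; simp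
  rw [e]
  refine integral_mono (F.integrable_max z') ((F.integrable_max z).add (integrable_const _)) ?_
  intro x
  show max z' x ≤ max z x + (z' - z)
  rcases max_cases z' x with h1 | h1 <;> rcases max_cases z x with h2 | h2 <;> linarith

/-- The net gain of opening a box over the sure value `z` is negative above the reservation
value. -/
theorem gain_neg (hβ0 : 0 < β) (hβ1 : β ≤ 1) (hc : 0 ≤ c) (hs : c < β * μ)
    (hf : 0 < c ∨ β < 1) (F : Strategy μ) {z : ℝ} (hz : reservationValue c β F < z) :
    -c + β * (∫ x, max z x ∂F.law) < z := by
  have h1 := reservationValue_spec hβ0 hβ1 hc hs hf F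
  have h2 := F.integral_max_le_add hz.le
  have hle : -c + β * (∫ x, max z x ∂F.law) ≤ z := by
    have := mul_le_mul_of_nonneg_left h2 hβ0.le
    nlinarith
  refine lt_of_le_of_ne hle fun he => ?_
  exact hz.ne' ((existsUnique_isReservationValue hβ0 hβ1 hc hs hf F).unique he.symm h1)

/-- The net gain `-c + β ∫ max z x - z` is nonincreasing in `z` and has a single zero, so its sign
at `z` tells on which side the reservation value lies. -/
theorem lt_reservationValue (hβ0 : 0 < β) (hβ1 : β ≤ 1) (hc : 0 ≤ c) (hs : c < β * μ)
    (hf : 0 < c ∨ β < 1) (F : Strategy μ) {z : ℝ} (hz : z < -c + β * (∫ x, max z x ∂F.law)) :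
    z < reservationValue c β F := by
  rcases lt_trichotomy z (reservationValue c β F) with h | h | h
  · exact h
  · have := reservationValue_spec hβ0 hβ1 hc hs hf F
    rw [← h] at this
    linarith
  · have := gain_neg hβ0 hβ1 hc hs hf F h
    linarith

theorem reservationValue_lt (hβ0 : 0 < β) (hβ1 : β ≤ 1) (hc : 0 ≤ c) (hs : c < β * μ)
    (hf : 0 < c ∨ β < 1) (F : Strategy μ) {z : ℝ} (hz : -c + β * (∫ x, max z x ∂F.law) < z) :
    reservationValue c β F < z := by
  rcases lt_trichotomy z (reservationValue c β F) with h | h | h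
  · have h1 := reservationValue_spec hβ0 hβ1 hc hs hf F
    have h2 := F.integral_max_le_add h.le
    have := mul_le_mul_of_nonneg_left h2 hβ0.le
    nlinarith
  · have := reservationValue_spec hβ0 hβ1 hc hs hf F
    rw [← h] at this
    linarith
  · exact h

theorem reservationValue_pos (hβ0 : 0 < β) (hβ1 : β ≤ 1) (hc : 0 ≤ c) (hs : c < β * μ)
    (hf : 0 < c ∨ β < 1) (F : Strategy μ) : 0 < reservationValue c β F := by
  refine lt_reservationValue hβ0 hβ1 hc hs hf F ?_
  have h0 : ∫ x, max 0 x ∂F.law = μ := by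
    refine Eq.trans (integral_congr_ae ?_) F.mean
    filter_upwards [F.ae_mem] with x hx using max_eq_right hx.1
  rw [h0]; linarith

theorem reservationValue_lt_one (hβ0 : 0 < β) (hβ1 : β ≤ 1) (hc : 0 ≤ c) (hs : c < β * μ)
    (hf : 0 < c ∨ β < 1) (F : Strategy μ) : reservationValue c β F < 1 := by
  refine reservationValue_lt hβ0 hβ1 hc hs hf F ?_
  have h1 : ∫ x, max 1 x ∂F.law = 1 := by
    have : ∀ᵐ x ∂F.law, max 1 x = 1 := by
      filter_upwards [F.ae_mem] with x hx using max_eq_left hx.2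
    rw [integral_congr_ae this]; simp
  rw [h1]; rcases hf with h | h <;> linarith

theorem Strategy.integrable_excess (F : Strategy μ) (z : ℝ) :
    Integrable (fun x : ℝ => max (x - z) 0) F.law :=
  (F.integrable_id.sub (integrable_const z)).sup (integrable_const 0)

/-- The cost of opening a box is the expected value of its excess over the reservation value. -/
theorem integral_excess (hβ0 : 0 < β) (hβ1 : β ≤ 1) (hc : 0 ≤ c) (hs : c < β * μ)
    (hf : 0 < c ∨ β < 1) (F : Strategy μ) :
    β * ∫ x, max (x - reservationValue c β F) 0 ∂F.law
      = c + (1 - β) * reservationValue c β F := by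
  have h := reservationValue_spec hβ0 hβ1 hc hs hf F
  set z := reservationValue c β F
  have e : ∫ x, max z x ∂F.law = (∫ x, max (x - z) 0 ∂F.law) + z := by
    have : ∫ x, max z x ∂F.law = ∫ x, (max (x - z) 0 + z) ∂F.law := by
      refine integral_congr_ae (Filter.Eventually.of_forall fun x => ?_)
      show max z x = max (x - z) 0 + z
      rcases max_cases z x with h1 | h1 <;> rcases max_cases (x - z) 0 with h2 | h2 <;> linarith
    rw [this, integral_add (F.integrable_excess z) (integrable_const _)]; simp
  rw [e] at h
  linarith

/-- Frictions make the right side of `integral_excess` positive, so the excess cannot vanish almost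
surely. This mass is the source of profit in (i) and also feeds the independence argument about
optimal policies. -/
theorem measure_Ioi_reservationValue_pos (hβ0 : 0 < β) (hβ1 : β ≤ 1) (hc : 0 ≤ c)
    (hs : c < β * μ) (hf : 0 < c ∨ β < 1) (F : Strategy μ) :
    0 < F.law (Ioi (reservationValue c β F)) := by
  refine pos_iff_ne_zero.2 fun h0 => ?_
  have h := integral_excess hβ0 hβ1 hc hs hf F
  have hz := reservationValue_pos hβ0 hβ1 hc hs hf F
  have : ∫ x, max (x - reservationValue c β F) 0 ∂F.law = 0 := by
    refine integral_eq_zero_of_ae ?_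
    have : ∀ᵐ x ∂F.law, x ∉ Ioi (reservationValue c β F) := measure_eq_zero_iff_ae_notMem.1 h0
    filter_upwards [this] with x hx
    simp only [mem_Ioi, not_lt] at hx
    exact max_eq_right (by linarith)
  rw [this] at h
  rcases hf with h' | h'
  · nlinarith
  · nlinarith

end ReservationValue

/-! ### Full revelation and mixtures with it -/

section FullyRevealing

theorem integral_fullyRevealing (h0 : 0 ≤ μ) (h1 : μ ≤ 1) (f : ℝ → ℝ) :
    ∫ x, f x ∂(fullyRevealing μ h0 h1).law = (1 - μ) * f 0 + μ * f 1 := by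
  show ∫ x, f x ∂(ENNReal.ofReal (1 - μ) • Measure.dirac (0 : ℝ)
    + ENNReal.ofReal μ • Measure.dirac (1 : ℝ)) = _
  rw [integral_add_measure ((integrable_dirac (by simp)).smul_measure (by simp))
    ((integrable_dirac (by simp)).smul_measure (by simp))]
  simp [h0, h1]

/-- A convex function has its largest expectation under the fully revealing signal. -/
theorem Strategy.integral_le_fullyRevealing (F : Strategy μ) (h0 : 0 ≤ μ) (h1 : μ ≤ 1)
    {f : ℝ → ℝ} (hf : ConvexOn ℝ univ f) :
    ∫ x, f x ∂F.law ≤ ∫ x, f x ∂(fullyRevealing μ h0 h1).law := by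
  rw [integral_fullyRevealing]
  have hlin : Integrable (fun x : ℝ => f 0 + (f 1 - f 0) * x) F.law :=
    (integrable_const _).add (F.integrable_id.const_mul _)
  have he : ∫ x, (f 0 + (f 1 - f 0) * x) ∂F.law = (1 - μ) * f 0 + μ * f 1 := by
    rw [integral_add (integrable_const _) (F.integrable_id.const_mul _), integral_const_mul,
      F.mean]
    simp only [integral_const, probReal_univ, one_smul]
    ring
  -- A convex function lies below its chord over `[0, 1]`, and the expectation of the chord depends
  -- on the mean alone.
  have hle : ∀ᵐ x ∂F.law, f x ≤ f 0 + (f 1 - f 0) * x := by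
    filter_upwards [F.ae_mem] with x hx
    have := hf.2 (mem_univ 0) (mem_univ 1) (sub_nonneg.2 hx.2) hx.1 (by ring)
    simp only [smul_eq_mul, mul_zero, mul_one, zero_add] at this
    linarith
  rw [← he]
  have hcont : Continuous f := by
    have := hf.continuousOn isOpen_univ
    exact continuousOn_univ.1 this
  have hfi : Integrable f F.law := by
    obtain ⟨C, hC⟩ := (isCompact_Icc (a := (0 : ℝ)) (b := 1)).exists_bound_of_continuousOn
      hcont.continuousOn
    refine Integrable.of_bound hcont.aestronglyMeasurable C ?_
    filter_upwards [F.ae_mem] with x hx using hC x hx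
  exact integral_mono_ae hfi hlin hle

theorem convexOn_max_const (z : ℝ) : ConvexOn ℝ univ (fun x : ℝ => max z x) :=
  (convexOn_const z convex_univ).sup (convexOn_id convex_univ)

/-- Only the fully revealing signal maximizes the expectation of `max z x`, for `0 < z < 1`. -/
theorem Strategy.eq_fullyRevealing (F : Strategy μ) (h0 : 0 ≤ μ) (h1 : μ ≤ 1) {z : ℝ}
    (hz0 : 0 < z) (hz1 : z < 1)
    (h : ∫ x, max z x ∂(fullyRevealing μ h0 h1).law ≤ ∫ x, max z x ∂F.law) :
    F = fullyRevealing μ h0 h1 := by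
  -- The chord of `max z ·` over `[0, 1]` minus the function is nonnegative there and, by `h`, has
  -- integral `0`. As `0 < z < 1`, it vanishes only at the endpoints, so `F` lives on `{0, 1}` and
  -- the mean fixes both masses.
  have hlin : Integrable (fun x : ℝ => (z + (1 - z) * x) - max z x) F.law :=
    ((integrable_const z).add (F.integrable_id.const_mul _)).sub (F.integrable_max z)
  have hnn : ∀ᵐ x ∂F.law, 0 ≤ (z + (1 - z) * x) - max z x := by
    filter_upwards [F.ae_mem] with x hx
    rcases max_cases z x with h2 | h2 <;> rw [h2.1] <;> nlinarith [hx.1, hx.2]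
  have hint : ∫ x, ((z + (1 - z) * x) - max z x) ∂F.law = 0 := by
    refine le_antisymm ?_ (integral_nonneg_of_ae hnn)
    have e1 : ∫ x, ((z + (1 - z) * x) - max z x) ∂F.law
        = (∫ x, (z + (1 - z) * x) ∂F.law) - ∫ x, max z x ∂F.law :=
      integral_sub ((integrable_const z).add (F.integrable_id.const_mul _)) (F.integrable_max z)
    rw [e1, integral_add (integrable_const z) (F.integrable_id.const_mul _),
      integral_const_mul, F.mean]
    rw [integral_fullyRevealing, max_eq_left hz0.le, max_eq_right hz1.le] at h
    simp only [integral_const, probReal_univ, one_smul]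
    linarith
  have hae : ∀ᵐ x ∂F.law, x = 0 ∨ x = 1 := by
    filter_upwards [(integral_eq_zero_iff_of_nonneg_ae hnn hlin).1 hint] with x hx
    simp only [Pi.zero_apply] at hx
    rcases max_cases z x with h2 | h2 <;> rw [h2.1] at hx
    · left
      have : (1 - z) * x = 0 := by linarith
      rcases mul_eq_zero.1 this with h | h
      · linarith
      · exact h
    · right
      have : z * (1 - x) = 0 := by linarith
      rcases mul_eq_zero.1 this with h | h
      · linarith
      · linarith
  have hone : F.law {1} = ENNReal.ofReal μ := by
    have e : ∫ x, x ∂F.law = ∫ x, ({1} : Set ℝ).indicator 1 x ∂F.law := by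
      refine integral_congr_ae ?_
      filter_upwards [hae] with x hx
      rcases hx with rfl | rfl <;> simp
    rw [F.mean, integral_indicator_one (measurableSet_singleton _)] at e
    have e' : ENNReal.ofReal μ = ENNReal.ofReal (F.law.real {1}) := congrArg _ e
    rw [e']; simp
  have hzero : F.law {0} = ENNReal.ofReal (1 - μ) := by
    have e : ∫ x, (1 - x) ∂F.law = ∫ x, ({0} : Set ℝ).indicator 1 x ∂F.law := by
      refine integral_congr_ae ?_
      filter_upwards [hae] with x hx
      rcases hx with rfl | rfl <;> simp
    rw [integral_sub (integrable_const 1) F.integrable_id, F.mean,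
      integral_indicator_one (measurableSet_singleton _)] at e
    simp only [integral_const, probReal_univ, one_smul] at e
    rw [e]; simp
  have hlaw : F.law = ENNReal.ofReal (1 - μ) • Measure.dirac 0
      + ENNReal.ofReal μ • Measure.dirac 1 := by
    ext A hA
    have hsplit : F.law A = F.law (A ∩ {0}) + F.law (A ∩ {1}) := by
      rw [← measure_union _ (hA.inter (measurableSet_singleton _))]
      · refine measure_congr ?_
        filter_upwards [hae] with x hx
        refine propext ⟨fun hxA => ?_, fun hx' => ?_⟩
        · rcases hx with rfl | rfl
          · exact Or.inl ⟨hxA, rfl⟩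
          · exact Or.inr ⟨hxA, rfl⟩
        · rcases hx' with hx' | hx' <;> exact hx'.1
      · refine disjoint_left.2 fun x hx hx' => ?_
        have h1 : x = 0 := hx.2
        have h2 : x = 1 := hx'.2
        linarith
    have haux : ∀ a : ℝ, F.law (A ∩ {a}) = F.law {a} * Measure.dirac a A := by
      intro a
      by_cases ha : a ∈ A
      · rw [inter_eq_right.2 (singleton_subset_iff.2 ha)]; simp [ha]
      · rw [inter_singleton_eq_empty.2 ha]; simp [ha, hA]
    rw [hsplit, haux, haux, hone, hzero]
    simp
  cases F
  simp only [fullyRevealing, Strategy.mk.injEq]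
  exact hlaw

/-- The mixture of a signal with the fully revealing one. -/
noncomputable def Strategy.mixRevealing (F : Strategy μ) (h0 : 0 ≤ μ) (h1 : μ ≤ 1) (t : ℝ)
    (ht0 : 0 ≤ t) (ht1 : t ≤ 1) : Strategy μ where
  law := ENNReal.ofReal (1 - t) • F.law + ENNReal.ofReal t • (fullyRevealing μ h0 h1).law
  isProb := by
    constructor
    have h : ENNReal.ofReal (1 - t) + ENNReal.ofReal t = 1 := by
      rw [← ENNReal.ofReal_add (by linarith) ht0]; simp
    simpa using h
  support := by simp [F.support, (fullyRevealing μ h0 h1).support]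
  mean := by
    rw [integral_add_measure (F.integrable_id.smul_measure (by simp))
      ((fullyRevealing μ h0 h1).integrable_id.smul_measure (by simp)),
      integral_smul_measure, integral_smul_measure, F.mean, (fullyRevealing μ h0 h1).mean,
      ENNReal.toReal_ofReal (by linarith), ENNReal.toReal_ofReal ht0]
    simp only [smul_eq_mul]; ring

theorem Strategy.integral_mixRevealing (F : Strategy μ) (h0 : 0 ≤ μ) (h1 : μ ≤ 1) (t : ℝ)
    (ht0 : 0 ≤ t) (ht1 : t ≤ 1) {f : ℝ → ℝ} (hf : Continuous f) :
    ∫ x, f x ∂(F.mixRevealing h0 h1 t ht0 ht1).law = (1 - t) * ∫ x, f x ∂F.law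
      + t * ∫ x, f x ∂(fullyRevealing μ h0 h1).law := by
  have hfi : ∀ H : Strategy μ, Integrable f H.law := by
    intro H
    obtain ⟨C, hC⟩ := (isCompact_Icc (a := (0 : ℝ)) (b := 1)).exists_bound_of_continuousOn
      hf.continuousOn
    refine Integrable.of_bound hf.aestronglyMeasurable C ?_
    filter_upwards [H.ae_mem] with x hx using hC x hx
  show ∫ x, f x ∂(ENNReal.ofReal (1 - t) • F.law
    + ENNReal.ofReal t • (fullyRevealing μ h0 h1).law) = _
  rw [integral_add_measure ((hfi _).smul_measure (by simp)) ((hfi _).smul_measure (by simp)),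
      integral_smul_measure, integral_smul_measure, ENNReal.toReal_ofReal (by linarith),
      ENNReal.toReal_ofReal ht0]
  rfl

theorem Strategy.moreInformative_mixRevealing (F : Strategy μ) (h0 : 0 ≤ μ) (h1 : μ ≤ 1) (t : ℝ)
    (ht0 : 0 ≤ t) (ht1 : t ≤ 1) : MoreInformative (F.mixRevealing h0 h1 t ht0 ht1) F := by
  intro f hf
  have hcont : Continuous f := continuousOn_univ.1 (hf.continuousOn isOpen_univ)
  rw [F.integral_mixRevealing h0 h1 t ht0 ht1 hcont]
  nlinarith [F.integral_le_fullyRevealing h0 h1 hf]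

theorem Strategy.abs_mixRevealing_sub_le (F : Strategy μ) (h0 : 0 ≤ μ) (h1 : μ ≤ 1) (t : ℝ)
    (ht0 : 0 ≤ t) (ht1 : t ≤ 1) (A : Set ℝ) :
    |(F.mixRevealing h0 h1 t ht0 ht1).law.real A - F.law.real A| ≤ t := by
  have e : (F.mixRevealing h0 h1 t ht0 ht1).law.real A = (1 - t) * F.law.real A
      + t * (fullyRevealing μ h0 h1).law.real A := by
    show (ENNReal.ofReal (1 - t) • F.law
      + ENNReal.ofReal t • (fullyRevealing μ h0 h1).law).real A = _
    rw [measureReal_add_apply (by simp [ENNReal.mul_eq_top]) (by simp [ENNReal.mul_eq_top]),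
      measureReal_ennreal_smul_apply, measureReal_ennreal_smul_apply,
      ENNReal.toReal_ofReal (by linarith), ENNReal.toReal_ofReal ht0]
  have h2 : 0 ≤ F.law.real A := measureReal_nonneg
  have h3 : F.law.real A ≤ 1 := measureReal_le_one
  have h4 : 0 ≤ (fullyRevealing μ h0 h1).law.real A := measureReal_nonneg
  have h5 : (fullyRevealing μ h0 h1).law.real A ≤ 1 := measureReal_le_one
  rw [e, abs_le]
  constructor <;> nlinarith

end FullyRevealing

variable {n : ℕ}

/-! ### The index value as an integral over levels, and the loss of an action -/

section Levels

/-- The share of the sure rent at level `y` that is not lost to an open box of value `a`. -/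
noncomputable def openLevel (a y : ℝ) : ℝ := if a ≤ y then 1 else 0

/-- The discount that a closed box with reservation value `r` and value `a` puts on the level
`y`: it is not opened for the sake of levels above `r`, it is opened in vain at the levels
between `a` and `r`, and it ends the search at the levels below both. -/
noncomputable def closedLevel (β r a y : ℝ) : ℝ := if r ≤ y then 1 else if a ≤ y then β else 0

/-- The factor of box `i` at level `y`, when the boxes in `l` are open. -/
noncomputable def levelFactor (β : ℝ) (z x : Fin n → ℝ) (l : List (Fin n)) (y : ℝ)
    (i : Fin n) : ℝ :=
  if i ∈ l then openLevel (x i) y else closedLevel β (z i) (x i) y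

/-- The set `s` is a parameter so that one box can be taken out of the product, as `gap_of_closed`
requires. -/
noncomputable def levelProd (β : ℝ) (z x : Fin n → ℝ) (s : Finset (Fin n)) (l : List (Fin n))
    (y : ℝ) : ℝ :=
  ∏ i ∈ s, levelFactor β z x l y i

/-- The value of a history in the index problem in which the values `x` are known. -/
noncomputable def indexValue (β : ℝ) (z x : Fin n → ℝ) (l : List (Fin n)) : ℝ :=
  ∫ y in Ico (0 : ℝ) 1, (1 - levelProd β z x Finset.univ l y)

/-- The amended reward of opening a box: it has the mean `-c`. -/
noncomputable def openingReward (β r a : ℝ) : ℝ := (1 - β) * r - β * max (a - r) 0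

/-- The loss from an action at a history. -/
noncomputable def gap (β : ℝ) (z x : Fin n → ℝ) (l : List (Fin n)) (i : Fin n) : ℝ :=
  if i ∈ l then indexValue β z x l - x i
  else indexValue β z x l - (openingReward β (z i) (x i) + β * indexValue β z x (i :: l))

variable {β : ℝ} {z x : Fin n → ℝ} {l : List (Fin n)}

theorem levelFactor_nonneg (hβ0 : 0 < β) (y : ℝ) (i : Fin n) : 0 ≤ levelFactor β z x l y i := by
  unfold levelFactor openLevel closedLevel
  split_ifs <;> linarith

theorem levelFactor_le_one (hβ1 : β ≤ 1) (y : ℝ) (i : Fin n) :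
    levelFactor β z x l y i ≤ 1 := by
  unfold levelFactor openLevel closedLevel
  split_ifs <;> linarith

theorem levelProd_nonneg (hβ0 : 0 < β) (s : Finset (Fin n)) (y : ℝ) :
    0 ≤ levelProd β z x s l y :=
  Finset.prod_nonneg fun i _ => levelFactor_nonneg hβ0 y i

theorem levelProd_le_one (hβ0 : 0 < β) (hβ1 : β ≤ 1) (s : Finset (Fin n)) (y : ℝ) :
    levelProd β z x s l y ≤ 1 :=
  Finset.prod_le_one (fun i _ => levelFactor_nonneg hβ0 y i)
    fun i _ => levelFactor_le_one hβ1 y i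

theorem levelProd_eq_one {s : Finset (Fin n)} {y : ℝ} (h1 : ∀ i ∈ s, i ∈ l → x i ≤ y)
    (h2 : ∀ i ∈ s, i ∉ l → z i ≤ y) : levelProd β z x s l y = 1 := by
  refine Finset.prod_eq_one fun i hi => ?_
  unfold levelFactor openLevel closedLevel
  by_cases h : i ∈ l
  · simp [h, h1 i hi h]
  · simp [h, h2 i hi h]

theorem levelProd_eq_zero_of_open {s : Finset (Fin n)} {y : ℝ} {i : Fin n} (hs : i ∈ s)
    (hi : i ∈ l) (h : y < x i) : levelProd β z x s l y = 0 := by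
  refine Finset.prod_eq_zero hs ?_
  simp [levelFactor, openLevel, hi, h]

theorem levelProd_eq_zero_of_closed {s : Finset (Fin n)} {y : ℝ} {i : Fin n} (hs : i ∈ s)
    (hi : i ∉ l) (h : y < x i) (h' : y < z i) : levelProd β z x s l y = 0 := by
  refine Finset.prod_eq_zero hs ?_
  rw [levelFactor, closedLevel, if_neg hi, if_neg (not_le.2 h'), if_neg (not_le.2 h)]

theorem measurable_levelProd (s : Finset (Fin n)) :
    Measurable fun y => levelProd β z x s l y := by
  refine Finset.measurable_fun_prod _ fun i _ => ?_
  unfold levelFactor openLevel closedLevel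
  by_cases h : i ∈ l
  · simp only [h, if_true]
    exact Measurable.ite measurableSet_Ici measurable_const measurable_const
  · simp only [h, if_false]
    exact Measurable.ite measurableSet_Ici measurable_const
      (Measurable.ite measurableSet_Ici measurable_const measurable_const)

theorem integrable_of_mem_unit {g : ℝ → ℝ} (hg : Measurable g) (h0 : ∀ y, 0 ≤ g y)
    (h1 : ∀ y, g y ≤ 1) : Integrable g (volume.restrict (Ico (0 : ℝ) 1)) :=
  Integrable.of_bound hg.aestronglyMeasurable 1 (Filter.Eventually.of_forall fun y => by
    rw [Real.norm_eq_abs, abs_of_nonneg (h0 y)]; exact h1 y)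

theorem integrable_one_sub_levelProd (hβ0 : 0 < β) (hβ1 : β ≤ 1) (s : Finset (Fin n)) :
    Integrable (fun y => 1 - levelProd β z x s l y) (volume.restrict (Ico (0 : ℝ) 1)) :=
  integrable_of_mem_unit (measurable_const.sub (measurable_levelProd s))
    (fun y => sub_nonneg.2 (levelProd_le_one hβ0 hβ1 s y))
    fun y => sub_le_self _ (levelProd_nonneg hβ0 s y)

theorem integral_indicator_Ico_unit {a b : ℝ} (ha : 0 ≤ a) (hb : b ≤ 1) :
    ∫ y in Ico (0 : ℝ) 1, (Ico a b).indicator (fun _ => (1 : ℝ)) y = max (b - a) 0 := by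
  have h := integral_indicator_one (μ := volume.restrict (Ico (0 : ℝ) 1))
    (measurableSet_Ico (a := a) (b := b))
  refine h.trans ?_
  rw [measureReal_restrict_apply measurableSet_Ico,
    inter_eq_left.2 (show Ico a b ⊆ Ico 0 1 from fun y hy => ⟨ha.trans hy.1, hy.2.trans_le hb⟩),
    Real.volume_real_Ico]

/-- The rate at which opening a box is useless, at level `y`. -/
noncomputable def wasteRate (β r a y : ℝ) : ℝ :=
  (1 - β) * (Ico r 1).indicator (fun _ => (1 : ℝ)) y
    + β * (Ico r a).indicator (fun _ => (1 : ℝ)) y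

theorem wasteRate_nonneg (hβ0 : 0 < β) (hβ1 : β ≤ 1) (r a y : ℝ) : 0 ≤ wasteRate β r a y := by
  unfold wasteRate
  have h1 : 0 ≤ (Ico r 1).indicator (fun _ => (1 : ℝ)) y := indicator_nonneg (by simp) y
  have h2 : 0 ≤ (Ico r a).indicator (fun _ => (1 : ℝ)) y := indicator_nonneg (by simp) y
  have : 0 ≤ 1 - β := by linarith
  positivity

theorem wasteRate_le_one (hβ0 : 0 < β) (hβ1 : β ≤ 1) (r a y : ℝ) : wasteRate β r a y ≤ 1 := by
  unfold wasteRate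
  have h1 : (Ico r 1).indicator (fun _ => (1 : ℝ)) y ≤ 1 := by
    unfold Set.indicator; split_ifs <;> norm_num
  have h2 : (Ico r a).indicator (fun _ => (1 : ℝ)) y ≤ 1 := by
    unfold Set.indicator; split_ifs <;> norm_num
  have : 0 ≤ 1 - β := by linarith
  nlinarith

theorem measurable_wasteRate (β r a : ℝ) : Measurable (wasteRate β r a) :=
  ((measurable_const.indicator measurableSet_Ico).const_mul _).add
    ((measurable_const.indicator measurableSet_Ico).const_mul _)

theorem wasteRate_pos (hβ0 : 0 < β) (hβ1 : β ≤ 1) {r a y : ℝ} (h1 : r < y) (h2 : y < a) :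
    0 < wasteRate β r a y := by
  have h3 : 0 ≤ (Ico r 1).indicator (fun _ => (1 : ℝ)) y := indicator_nonneg (by simp) y
  have : 0 ≤ 1 - β := by linarith
  have h4 : (Ico r a).indicator (fun _ => (1 : ℝ)) y = 1 := indicator_of_mem (mem_Ico.2 ⟨h1.le, h2⟩) _
  unfold wasteRate
  rw [h4]
  positivity

theorem wasteRate_eq_zero {r a y : ℝ} (h : y < r) : wasteRate β r a y = 0 := by
  unfold wasteRate
  rw [indicator_of_notMem (notMem_Ico_of_lt h), indicator_of_notMem (notMem_Ico_of_lt h)]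
  ring

theorem integral_wasteRate {r a : ℝ} (hr0 : 0 ≤ r) (hr1 : r ≤ 1) (ha : a ≤ 1) :
    ∫ y in Ico (0 : ℝ) 1, wasteRate β r a y = (1 - β) - openingReward β r a := by
  unfold wasteRate openingReward
  rw [integral_add, integral_const_mul, integral_const_mul,
    integral_indicator_Ico_unit hr0 le_rfl, integral_indicator_Ico_unit hr0 ha,
    max_eq_left (sub_nonneg.2 hr1)]
  · ring
  · exact ((integrable_const _).indicator measurableSet_Ico).const_mul _
  · exact ((integrable_const _).indicator measurableSet_Ico).const_mul _

/-- The loss from opening a box. -/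
theorem gap_of_closed (hβ0 : 0 < β) (hβ1 : β ≤ 1) (hz : ∀ i, z i ∈ Icc (0 : ℝ) 1)
    (hx : ∀ i, x i ∈ Icc (0 : ℝ) 1) {i : Fin n} (hi : i ∉ l) :
    gap β z x l i = ∫ y in Ico (0 : ℝ) 1,
      wasteRate β (z i) (x i) y * (1 - levelProd β z x (Finset.univ.erase i) l y) := by
  have hw := integral_wasteRate (β := β) (hz i).1 (hz i).2 (hx i).2
  have hwi : Integrable (wasteRate β (z i) (x i)) (volume.restrict (Ico (0 : ℝ) 1)) :=
    integrable_of_mem_unit (measurable_wasteRate _ _ _) (wasteRate_nonneg hβ0 hβ1 _ _)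
      (wasteRate_le_one hβ0 hβ1 _ _)
  have h1 := integrable_one_sub_levelProd (z := z) (x := x) (l := l) hβ0 hβ1 Finset.univ
  have h2 := integrable_one_sub_levelProd (z := z) (x := x) (l := i :: l) hβ0 hβ1 Finset.univ
  have hc : ∫ _ in Ico (0 : ℝ) 1, (1 - β) = 1 - β := by simp
  have e : gap β z x l i = ∫ y in Ico (0 : ℝ) 1,
      (((1 - levelProd β z x Finset.univ l y)
        - β * (1 - levelProd β z x Finset.univ (i :: l) y))
        - ((1 - β) - wasteRate β (z i) (x i) y)) := by
    have e1 := integral_sub (h1.sub (h2.const_mul β)) ((integrable_const (1 - β)).sub hwi)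
    have e2 := integral_sub h1 (h2.const_mul β)
    have e3 := integral_sub (integrable_const (1 - β)) hwi
    rw [hw, hc] at e3
    rw [integral_const_mul] at e2
    refine Eq.trans ?_ (e1.trans (congrArg₂ (· - ·) e2 e3)).symm
    simp only [gap, hi, if_false, indexValue]
    ring
  rw [e]
  -- Opening box `i` changes only its own factor. With `P` the product over the other boxes, the
  -- integrand collapses to `wasteRate * (1 - P)`, because `wasteRate` equals `closedLevel - β *
  -- openLevel` on `[0, 1)`.
  refine setIntegral_congr_fun measurableSet_Ico fun y hy => ?_
  have s1 : levelProd β z x Finset.univ l y = closedLevel β (z i) (x i) y *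
      levelProd β z x (Finset.univ.erase i) l y := by
    unfold levelProd
    rw [← Finset.mul_prod_erase Finset.univ _ (Finset.mem_univ i)]
    simp [levelFactor, hi]
  have s2 : levelProd β z x Finset.univ (i :: l) y = openLevel (x i) y *
      levelProd β z x (Finset.univ.erase i) l y := by
    unfold levelProd
    rw [← Finset.mul_prod_erase Finset.univ _ (Finset.mem_univ i)]
    congr 1
    · simp [levelFactor]
    · refine Finset.prod_congr rfl fun j hj => ?_
      simp [levelFactor, Finset.ne_of_mem_erase hj]
  have s3 : wasteRate β (z i) (x i) y
      = closedLevel β (z i) (x i) y - β * openLevel (x i) y := by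
    unfold wasteRate closedLevel openLevel
    by_cases c1 : z i ≤ y
    · by_cases c2 : x i ≤ y
      · simp [c1, c2, hy.2]
      · simp [c1, c2, hy.2, not_le.1 c2]
    · by_cases c2 : x i ≤ y
      · simp [c1, c2]
      · simp [c1, c2]
  simp only [s1, s2, s3]
  ring

/-- The product is `0` at every level below the value of an open box: taking the box collects these
levels in full, and only levels above can be lost. -/
theorem gap_of_open (hβ0 : 0 < β) (hβ1 : β ≤ 1) (hx : ∀ i, x i ∈ Icc (0 : ℝ) 1)
    {i : Fin n} (hi : i ∈ l) :
    gap β z x l i = ∫ y in Ico (0 : ℝ) 1,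
      (if y < x i then 0 else 1 - levelProd β z x Finset.univ l y) := by
  have h1 := integrable_one_sub_levelProd (z := z) (x := x) (l := l) hβ0 hβ1 Finset.univ
  have h2 := integral_indicator_Ico_unit le_rfl (hx i).2
  rw [sub_zero, max_eq_left (hx i).1] at h2
  simp only [gap, hi, if_true, indexValue]
  rw [← h2, ← integral_sub h1 ((integrable_const _).indicator measurableSet_Ico)]
  · rw [h2]
    refine setIntegral_congr_fun measurableSet_Ico fun y hy => ?_
    by_cases hy' : y < x i
    · simp [hy', hy.1, levelProd_eq_zero_of_open (Finset.mem_univ i) hi hy']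
    · simp [hy']

theorem integrable_gap_of_closed (hβ0 : 0 < β) (hβ1 : β ≤ 1) (i : Fin n) :
    Integrable (fun y => wasteRate β (z i) (x i) y *
      (1 - levelProd β z x (Finset.univ.erase i) l y)) (volume.restrict (Ico (0 : ℝ) 1)) := by
  have h1 : ∀ y, 0 ≤ 1 - levelProd β z x (Finset.univ.erase i) l y := fun y =>
    sub_nonneg.2 (levelProd_le_one hβ0 hβ1 _ y)
  refine integrable_of_mem_unit ((measurable_wasteRate _ _ _).mul
    (measurable_const.sub (measurable_levelProd _)))
    (fun y => mul_nonneg (wasteRate_nonneg hβ0 hβ1 _ _ y) (h1 y)) fun y => ?_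
  exact mul_le_one₀ (wasteRate_le_one hβ0 hβ1 _ _ y) (h1 y)
    (sub_le_self _ (levelProd_nonneg hβ0 _ y))

theorem integrable_gap_of_open (hβ0 : 0 < β) (hβ1 : β ≤ 1) (i : Fin n) :
    Integrable (fun y => if y < x i then 0 else 1 - levelProd β z x Finset.univ l y)
      (volume.restrict (Ico (0 : ℝ) 1)) := by
  refine integrable_of_mem_unit (Measurable.ite measurableSet_Iio measurable_const
    (measurable_const.sub (measurable_levelProd _))) (fun y => ?_) fun y => ?_
  · split_ifs
    · exact le_rfl
    · exact sub_nonneg.2 (levelProd_le_one hβ0 hβ1 _ y)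
  · split_ifs
    · exact zero_le_one
    · exact sub_le_self _ (levelProd_nonneg hβ0 _ y)

theorem gap_nonneg (hβ0 : 0 < β) (hβ1 : β ≤ 1) (hz : ∀ i, z i ∈ Icc (0 : ℝ) 1)
    (hx : ∀ i, x i ∈ Icc (0 : ℝ) 1) (i : Fin n) : 0 ≤ gap β z x l i := by
  by_cases hi : i ∈ l
  · rw [gap_of_open hβ0 hβ1 hx hi]
    refine integral_nonneg fun y => ?_
    show 0 ≤ ite _ _ _
    split_ifs
    · exact le_rfl
    · exact sub_nonneg.2 (levelProd_le_one hβ0 hβ1 _ y)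
  · rw [gap_of_closed hβ0 hβ1 hz hx hi]
    exact integral_nonneg fun y => mul_nonneg (wasteRate_nonneg hβ0 hβ1 _ _ y)
      (sub_nonneg.2 (levelProd_le_one hβ0 hβ1 _ y))

theorem indexValue_nonneg (hβ0 : 0 < β) (hβ1 : β ≤ 1) : 0 ≤ indexValue β z x l :=
  integral_nonneg fun y => sub_nonneg.2 (levelProd_le_one hβ0 hβ1 _ y)

theorem indexValue_pos (hβ0 : 0 < β) (hβ1 : β ≤ 1) (hz : ∀ i, z i ∈ Icc (0 : ℝ) 1)
    {i : Fin n} (hi : i ∉ l) (h0 : 0 < z i) (h : z i < x i) : 0 < indexValue β z x l := by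
  refine setIntegral_Ico_pos (integrable_one_sub_levelProd hβ0 hβ1 _)
    (fun y => sub_nonneg.2 (levelProd_le_one hβ0 hβ1 _ y)) le_rfl h0 (hz i).2 fun y _ hy => ?_
  rw [levelProd_eq_zero_of_closed (Finset.mem_univ i) hi (hy.trans h) hy]
  simp

/-- Here and in the next three lemmas a wrong action loses on a whole interval of levels. Each
closed box involved is required to beat its reservation value, a condition on unseen values only,
which independence removes later. -/
theorem gap_open_pos_of_open (hβ0 : 0 < β) (hβ1 : β ≤ 1) (hx : ∀ i, x i ∈ Icc (0 : ℝ) 1)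
    {j k : Fin n} (hj : j ∈ l) (hk : k ∈ l) (h : x j < x k) : 0 < gap β z x l j := by
  rw [gap_of_open hβ0 hβ1 hx hj]
  refine setIntegral_Ico_pos (integrable_gap_of_open hβ0 hβ1 j) (fun y => ?_) (hx j).1 h (hx k).2
    fun y hy1 hy2 => ?_
  · split_ifs
    · exact le_rfl
    · exact sub_nonneg.2 (levelProd_le_one hβ0 hβ1 _ y)
  · rw [levelProd_eq_zero_of_open (Finset.mem_univ k) hk hy2]
    rw [if_neg (not_lt.2 hy1.le)]
    simp

theorem gap_open_pos_of_closed (hβ0 : 0 < β) (hβ1 : β ≤ 1) (hz : ∀ i, z i ∈ Icc (0 : ℝ) 1)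
    (hx : ∀ i, x i ∈ Icc (0 : ℝ) 1) {j k : Fin n} (hj : j ∈ l) (hk : k ∉ l) (h : x j < z k)
    (h' : z k < x k) : 0 < gap β z x l j := by
  rw [gap_of_open hβ0 hβ1 hx hj]
  refine setIntegral_Ico_pos (integrable_gap_of_open hβ0 hβ1 j) (fun y => ?_) (hx j).1 h (hz k).2
    fun y hy1 hy2 => ?_
  · split_ifs
    · exact le_rfl
    · exact sub_nonneg.2 (levelProd_le_one hβ0 hβ1 _ y)
  · rw [levelProd_eq_zero_of_closed (Finset.mem_univ k) hk (hy2.trans h') hy2]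
    rw [if_neg (not_lt.2 hy1.le)]
    simp

theorem gap_closed_pos_of_open (hβ0 : 0 < β) (hβ1 : β ≤ 1) (hz : ∀ i, z i ∈ Icc (0 : ℝ) 1)
    (hx : ∀ i, x i ∈ Icc (0 : ℝ) 1) {i k : Fin n} (hi : i ∉ l) (hk : k ∈ l) (h : z i < x k)
    (h' : z i < x i) : 0 < gap β z x l i := by
  rw [gap_of_closed hβ0 hβ1 hz hx hi]
  refine setIntegral_Ico_pos (integrable_gap_of_closed hβ0 hβ1 i)
    (fun y => mul_nonneg (wasteRate_nonneg hβ0 hβ1 _ _ y)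
      (sub_nonneg.2 (levelProd_le_one hβ0 hβ1 _ y))) (hz i).1 (lt_min h h')
    ((min_le_left _ _).trans (hx k).2) fun y hy1 hy2 => ?_
  have hki : k ≠ i := fun e => hi (e ▸ hk)
  rw [levelProd_eq_zero_of_open (Finset.mem_erase.2 ⟨hki, Finset.mem_univ k⟩) hk
    (hy2.trans_le (min_le_left _ _)), sub_zero, mul_one]
  exact wasteRate_pos hβ0 hβ1 hy1 (hy2.trans_le (min_le_right _ _))

theorem gap_closed_pos_of_closed (hβ0 : 0 < β) (hβ1 : β ≤ 1) (hz : ∀ i, z i ∈ Icc (0 : ℝ) 1)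
    (hx : ∀ i, x i ∈ Icc (0 : ℝ) 1) {i k : Fin n} (hi : i ∉ l) (hk : k ∉ l) (h : z i < z k)
    (h' : z i < x i) (hk' : z k < x k) : 0 < gap β z x l i := by
  rw [gap_of_closed hβ0 hβ1 hz hx hi]
  refine setIntegral_Ico_pos (integrable_gap_of_closed hβ0 hβ1 i)
    (fun y => mul_nonneg (wasteRate_nonneg hβ0 hβ1 _ _ y)
      (sub_nonneg.2 (levelProd_le_one hβ0 hβ1 _ y))) (hz i).1 (lt_min h h')
    ((min_le_left _ _).trans (hz k).2) fun y hy1 hy2 => ?_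
  have hki : k ≠ i := by rintro rfl; exact lt_irrefl _ h
  have hyk := hy2.trans_le (min_le_left _ _)
  rw [levelProd_eq_zero_of_closed (Finset.mem_erase.2 ⟨hki, Finset.mem_univ k⟩) hk
    (hyk.trans hk') hyk, sub_zero, mul_one]
  exact wasteRate_pos hβ0 hβ1 hy1 (hy2.trans_le (min_le_right _ _))

/-- Below `z i` nothing is wasted, and from `z i` upwards all the other factors are `1`. -/
theorem gap_closed_eq_zero (hβ0 : 0 < β) (hβ1 : β ≤ 1) (hz : ∀ i, z i ∈ Icc (0 : ℝ) 1)
    (hx : ∀ i, x i ∈ Icc (0 : ℝ) 1) {i : Fin n} (hi : i ∉ l) (h1 : ∀ k, k ∉ l → z k ≤ z i)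
    (h2 : ∀ j ∈ l, x j ≤ z i) : gap β z x l i = 0 := by
  rw [gap_of_closed hβ0 hβ1 hz hx hi]
  refine integral_eq_zero_of_ae (Filter.Eventually.of_forall fun y => ?_)
  show _ * _ = (0 : ℝ)
  by_cases hy : y < z i
  · rw [wasteRate_eq_zero hy, zero_mul]
  · rw [not_lt] at hy
    rw [levelProd_eq_one (fun j _ hj => (h2 j hj).trans hy) fun k _ hk => (h1 k hk).trans hy]
    ring

theorem gap_open_eq_zero (hβ0 : 0 < β) (hβ1 : β ≤ 1)
    (hx : ∀ i, x i ∈ Icc (0 : ℝ) 1) {j : Fin n} (hj : j ∈ l) (h1 : ∀ k ∈ l, x k ≤ x j)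
    (h2 : ∀ i, i ∉ l → z i ≤ x j) : gap β z x l j = 0 := by
  rw [gap_of_open hβ0 hβ1 hx hj]
  refine integral_eq_zero_of_ae (Filter.Eventually.of_forall fun y => ?_)
  show ite _ _ _ = (0 : ℝ)
  by_cases hy : y < x j
  · simp [hy]
  · rw [not_lt] at hy
    rw [levelProd_eq_one (fun k _ hk => (h1 k hk).trans hy) fun k _ hk => (h2 k hk).trans hy]
    simp

end Levels

/-! ### Amended utility: the pathwise bound and the case of equality -/

section Amended

/-- Pandora's continuation utility with the amended rewards of opening boxes. -/
noncomputable def Policy.amendedFrom (p : Policy n) (β : ℝ) (z x : Fin n → ℝ) :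
    ℕ → List (Fin n) → ℝ
  | 0, l => ∑ i, if i ∈ l then p.prob l x (some i) * x i else 0
  | k + 1, l => ∑ i, if i ∈ l then p.prob l x (some i) * x i
      else p.prob l x (some i) *
        (openingReward β (z i) (x i) + β * Policy.amendedFrom p β z x k (i :: l))

/-- The probability that the boxes in `l` are opened in this order. -/
def Policy.reach (p : Policy n) (x : Fin n → ℝ) : List (Fin n) → ℝ
  | [] => 1
  | i :: l => Policy.reach p x l * p.prob l x (some i)

variable {β : ℝ} {z x : Fin n → ℝ}

theorem Policy.reach_nonneg (p : Policy n) (l : List (Fin n)) : 0 ≤ p.reach x l := by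
  induction l with
  | nil => exact zero_le_one
  | cons i l ih => exact mul_nonneg ih (p.nonneg _ _ _)

theorem Policy.prob_none_add (p : Policy n) (l : List (Fin n)) (x : Fin n → ℝ) :
    p.prob l x none + ∑ i, p.prob l x (some i) = 1 := by
  rw [← Fintype.sum_option, p.sum_eq_one]

theorem mem_of_nodup_of_le_length {l : List (Fin n)} (hl : l.Nodup) (h : n ≤ l.length)
    (i : Fin n) : i ∈ l := by
  have : l.toFinset = Finset.univ := by
    rw [← Finset.card_eq_iff_eq_univ, List.toFinset_card_of_nodup hl, Fintype.card_fin]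
    exact le_antisymm (by simpa using hl.length_le_card) h
  rw [← List.mem_toFinset, this]
  exact Finset.mem_univ i

/-- With no closed box left the remaining budget is irrelevant, so base cases of inductions reduce
to a successor step. -/
theorem Policy.amendedFrom_zero (p : Policy n) {l : List (Fin n)} (h : ∀ i, i ∈ l) :
    p.amendedFrom β z x 0 l = p.amendedFrom β z x 1 l := by
  simp [Policy.amendedFrom, h]

/-- The shortfall from the index value splits into the loss from stopping with nothing, the
immediate loss `gap` of each other action, and the discounted shortfall at the next history. Both
the upper bound and the analysis of equality are read off from this identity. -/
theorem Policy.indexValue_sub_amendedFrom_succ (p : Policy n) (k : ℕ) (l : List (Fin n)) :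
    indexValue β z x l - p.amendedFrom β z x (k + 1) l
      = p.prob l x none * indexValue β z x l + ∑ i, p.prob l x (some i) * (gap β z x l i
        + if i ∈ l then 0
          else β * (indexValue β z x (i :: l) - p.amendedFrom β z x k (i :: l))) := by
  have h : indexValue β z x l = p.prob l x none * indexValue β z x l
      + ∑ i, p.prob l x (some i) * indexValue β z x l := by
    rw [← Finset.sum_mul, ← add_mul, p.prob_none_add, one_mul]
  have e : p.amendedFrom β z x (k + 1) l = ∑ i, if i ∈ l then p.prob l x (some i) * x i
      else p.prob l x (some i) *
        (openingReward β (z i) (x i) + β * p.amendedFrom β z x k (i :: l)) := rfl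
  rw [e]
  nth_rewrite 1 [h]
  rw [add_sub_assoc, ← Finset.sum_sub_distrib]
  congr 1
  refine Finset.sum_congr rfl fun i _ => ?_
  unfold gap
  split_ifs <;> ring

/-- Every term of the shortfall identity is nonnegative. The condition `n ≤ k + l.length` says that
the budget suffices for all closed boxes. -/
theorem Policy.amendedFrom_le (p : Policy n) (hβ0 : 0 < β) (hβ1 : β ≤ 1)
    (hz : ∀ i, z i ∈ Icc (0 : ℝ) 1) (hx : ∀ i, x i ∈ Icc (0 : ℝ) 1) (k : ℕ) :
    ∀ l : List (Fin n), l.Nodup → n ≤ k + l.length →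
      p.amendedFrom β z x k l ≤ indexValue β z x l := by
  have step : ∀ (k : ℕ) (l : List (Fin n)), (∀ i, i ∉ l →
      p.amendedFrom β z x k (i :: l) ≤ indexValue β z x (i :: l)) →
      p.amendedFrom β z x (k + 1) l ≤ indexValue β z x l := by
    intro k l h
    rw [← sub_nonneg, p.indexValue_sub_amendedFrom_succ]
    refine add_nonneg (mul_nonneg (p.nonneg _ _ _) (indexValue_nonneg hβ0 hβ1))
      (Finset.sum_nonneg fun i _ => mul_nonneg (p.nonneg _ _ _)
        (add_nonneg (gap_nonneg hβ0 hβ1 hz hx i) ?_))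
    split_ifs with hi
    · exact le_rfl
    · exact mul_nonneg hβ0.le (sub_nonneg.2 (h i hi))
  induction k with
  | zero =>
    intro l hl hn
    have hall := mem_of_nodup_of_le_length hl (by simpa using hn)
    rw [p.amendedFrom_zero hall]
    exact step 0 l fun i hi => absurd (hall i) hi
  | succ k ih =>
    intro l hl hn
    exact step k l fun i hi => ih _ (List.nodup_cons.2 ⟨hi, hl⟩) (by simp; omega)

/-- Where a policy attains the index value, it makes no loss at the histories it reaches. -/
theorem Policy.no_loss_of_amendedFrom_eq (p : Policy n) (hβ0 : 0 < β) (hβ1 : β ≤ 1)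
    (hz : ∀ i, z i ∈ Icc (0 : ℝ) 1) (hx : ∀ i, x i ∈ Icc (0 : ℝ) 1)
    (h : p.amendedFrom β z x n [] = indexValue β z x []) (l : List (Fin n)) (hl : l.Nodup)
    (hr : 0 < p.reach x l) :
    p.prob l x none * indexValue β z x l = 0 ∧
      ∀ i, p.prob l x (some i) * gap β z x l i = 0 := by
  -- A vanishing sum of nonnegative terms: equality at `l` forces every loss there to be `0` and
  -- passes on to each history that follows with positive probability.
  have step : ∀ (k : ℕ) (l : List (Fin n)), l.Nodup → n ≤ k + 1 + l.length →
      p.amendedFrom β z x (k + 1) l = indexValue β z x l →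
      (p.prob l x none * indexValue β z x l = 0 ∧
        ∀ i, p.prob l x (some i) * gap β z x l i = 0) ∧
      ∀ i, i ∉ l → 0 < p.prob l x (some i) →
        p.amendedFrom β z x k (i :: l) = indexValue β z x (i :: l) := by
    intro k l hl hn he
    have hid := p.indexValue_sub_amendedFrom_succ (β := β) (z := z) (x := x) k l
    rw [he, sub_self] at hid
    have hD : ∀ i, 0 ≤ if i ∈ l then 0
        else β * (indexValue β z x (i :: l) - p.amendedFrom β z x k (i :: l)) := by
      intro i
      split_ifs with hi
      · exact le_rfl
      · exact mul_nonneg hβ0.le (sub_nonneg.2 (p.amendedFrom_le hβ0 hβ1 hz hx k _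
          (List.nodup_cons.2 ⟨hi, hl⟩) (by simp; omega)))
    have hg : ∀ i, 0 ≤ gap β z x l i := gap_nonneg hβ0 hβ1 hz hx
    have h1 : 0 ≤ p.prob l x none * indexValue β z x l :=
      mul_nonneg (p.nonneg _ _ _) (indexValue_nonneg hβ0 hβ1)
    have h2 : ∀ i ∈ Finset.univ, 0 ≤ p.prob l x (some i) * (gap β z x l i + if i ∈ l then 0
        else β * (indexValue β z x (i :: l) - p.amendedFrom β z x k (i :: l))) := fun i _ =>
      mul_nonneg (p.nonneg _ _ _) (add_nonneg (hg i) (hD i))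
    have h3 := Finset.sum_nonneg h2
    have h4 := (Finset.sum_eq_zero_iff_of_nonneg h2).1 (by linarith)
    refine ⟨⟨by linarith, fun i => ?_⟩, fun i hi hp => ?_⟩
    · have := h4 i (Finset.mem_univ i)
      have a := mul_nonneg (p.nonneg l x (some i)) (hg i)
      have b := mul_nonneg (p.nonneg l x (some i)) (hD i)
      rw [mul_add] at this
      linarith
    · have h5 := h4 i (Finset.mem_univ i)
      rcases mul_eq_zero.1 h5 with h6 | h6
      · exact absurd h6 hp.ne'
      · have h7 : (if i ∈ l then 0
            else β * (indexValue β z x (i :: l) - p.amendedFrom β z x k (i :: l))) = 0 := by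
          linarith [hg i, hD i]
        rw [if_neg hi] at h7
        rcases mul_eq_zero.1 h7 with h8 | h8
        · exact absurd h8 hβ0.ne'
        · linarith
  have main : ∀ (l : List (Fin n)), l.Nodup → 0 < p.reach x l → ∀ k, k + l.length = n →
      p.amendedFrom β z x k l = indexValue β z x l := by
    intro l
    induction l with
    | nil => intro _ _ k hk; simp at hk; rw [hk]; exact h
    | cons i l ih =>
      intro hl hr k hk
      have hl' := List.nodup_cons.1 hl
      have hr1 : 0 < p.reach x l := by
        refine lt_of_le_of_ne (p.reach_nonneg l) fun e => ?_
        simp [Policy.reach, ← e] at hr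
      have hr2 : 0 < p.prob l x (some i) := by
        refine lt_of_le_of_ne (p.nonneg _ _ _) fun e => ?_
        simp [Policy.reach, ← e] at hr
      have hk' : k + 1 + l.length = n := by simp at hk; omega
      exact (step k l hl'.2 hk'.ge (ih hl'.2 hr1 (k + 1) hk')).2 i hl'.1 hr2
  have hlen : l.length ≤ n := by simpa using hl.length_le_card
  have hm := main l hl hr (n - l.length) (by omega)
  rcases Nat.eq_zero_or_pos (n - l.length) with h0 | h0
  · have hall := mem_of_nodup_of_le_length hl (by omega)
    rw [h0, p.amendedFrom_zero hall] at hm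
    exact (step 0 l hl (by omega) hm).1
  · obtain ⟨k, hk⟩ : ∃ k, n - l.length = k + 1 := ⟨n - l.length - 1, by omega⟩
    rw [hk] at hm
    exact (step k l hl (by omega) hm).1

end Amended

/-! ### Weitzman's rule as a policy that attains the bound -/

section WeitzmanPolicy

/-- The first opened box among those with the largest value seen. -/
noncomputable def bestOpen (x : Fin n → ℝ) : List (Fin n) → Option (Fin n)
  | [] => none
  | i :: l => match bestOpen x l with
    | none => some i
    | some j => if x j < x i then some i else some j

theorem bestOpen_eq_none {x : Fin n → ℝ} {l : List (Fin n)} (h : bestOpen x l = none) :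
    l = [] := by
  cases l with
  | nil => rfl
  | cons i l =>
    exfalso
    unfold bestOpen at h
    cases hb : bestOpen x l with
    | none => simp [hb] at h
    | some j =>
      rw [hb] at h
      simp only at h
      split_ifs at h

theorem bestOpen_eq_some {x : Fin n → ℝ} {l : List (Fin n)} :
    ∀ {j : Fin n}, bestOpen x l = some j → j ∈ l ∧ ∀ k ∈ l, x k ≤ x j := by
  induction l with
  | nil => intro j h; simp [bestOpen] at h
  | cons i l ih =>
    intro j h
    unfold bestOpen at h
    cases hb : bestOpen x l with
    | none =>
      rw [hb] at h
      simp only [Option.some.injEq] at h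
      subst h
      have := bestOpen_eq_none hb
      subst this
      simp
    | some m =>
      rw [hb] at h
      simp only at h
      obtain ⟨h1, h2⟩ := ih hb
      split_ifs at h with hlt
      · simp only [Option.some.injEq] at h
        subst h
        refine ⟨by simp, fun k hk => ?_⟩
        rcases List.mem_cons.1 hk with rfl | hk
        · exact le_rfl
        · exact (h2 k hk).trans hlt.le
      · simp only [Option.some.injEq] at h
        subst h
        refine ⟨List.mem_cons_of_mem _ h1, fun k hk => ?_⟩
        rcases List.mem_cons.1 hk with rfl | hk
        · exact not_lt.1 hlt
        · exact h2 k hk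

theorem bestOpen_congr {x y : Fin n → ℝ} {l : List (Fin n)} (h : ∀ i ∈ l, x i = y i) :
    bestOpen x l = bestOpen y l := by
  induction l with
  | nil => rfl
  | cons i l ih =>
    have ih' := ih fun k hk => h k (List.mem_cons_of_mem _ hk)
    unfold bestOpen
    rw [ih']
    cases hb : bestOpen y l with
    | none => rfl
    | some j =>
      have hj := (bestOpen_eq_some hb).1
      simp only [h i (by simp), h j (List.mem_cons_of_mem _ hj)]

theorem measurableSet_bestOpen (l : List (Fin n)) (a : Option (Fin n)) :
    MeasurableSet {x : Fin n → ℝ | bestOpen x l = a} := by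
  induction l generalizing a with
  | nil => simp [bestOpen]
  | cons i l ih =>
    have e : {x : Fin n → ℝ | bestOpen x (i :: l) = a}
        = ({x | bestOpen x l = none} ∩ {_x | some i = a}) ∪ ⋃ j : Fin n,
          ({x | bestOpen x l = some j} ∩
            (({x | x j < x i} ∩ {_x | some i = a}) ∪ ({x | x j < x i}ᶜ ∩ {_x | some j = a}))) := by
      ext x
      cases hb : bestOpen x l with
      | none => simp [bestOpen, hb]
      | some j =>
        by_cases hlt : x j < x i
        · simp [bestOpen, hb, hlt]
        · simp only [bestOpen, hb, hlt, mem_ofPred_eq, mem_union, mem_inter_iff, mem_iUnion,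
            mem_compl_iff, Option.some.injEq, if_false, reduceCtorEq, false_and, false_or,
            not_false_eq_true, true_and, exists_eq_left']
    rw [e]
    have hlt : ∀ j : Fin n, MeasurableSet {x : Fin n → ℝ | x j < x i} := fun j =>
      measurableSet_lt (measurable_pi_apply j) (measurable_pi_apply i)
    exact ((ih _).inter (MeasurableSet.const _)).union (MeasurableSet.iUnion fun j =>
      (ih _).inter (((hlt j).inter (MeasurableSet.const _)).union
        ((hlt j).compl.inter (MeasurableSet.const _))))

/-- The action of Weitzman's rule when the next box is `m l`: open it unless a better value has
been seen. -/
noncomputable def weitzmanAction (z : Fin n → ℝ) (m : List (Fin n) → Option (Fin n))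
    (l : List (Fin n)) (x : Fin n → ℝ) : Option (Fin n) :=
  open Classical in
  match m l with
  | none => bestOpen x l
  | some i => if ∀ j ∈ l, x j ≤ z i then some i else bestOpen x l

theorem measurableSet_weitzmanAction (z : Fin n → ℝ) (m : List (Fin n) → Option (Fin n))
    (l : List (Fin n)) (a : Option (Fin n)) :
    MeasurableSet {x : Fin n → ℝ | weitzmanAction z m l x = a} := by
  cases hm : m l with
  | none => simpa [weitzmanAction, hm] using measurableSet_bestOpen l a
  | some i =>
    have hE : MeasurableSet {x : Fin n → ℝ | ∀ j ∈ l, x j ≤ z i} := by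
      have : {x : Fin n → ℝ | ∀ j ∈ l, x j ≤ z i} = ⋂ j, ⋂ (_ : j ∈ l), {x | x j ≤ z i} := by
        ext x; simp
      rw [this]
      exact MeasurableSet.iInter fun j => MeasurableSet.iInter fun _ =>
        measurableSet_le (measurable_pi_apply j) measurable_const
    have e : {x : Fin n → ℝ | weitzmanAction z m l x = a}
        = ({x | ∀ j ∈ l, x j ≤ z i} ∩ {_x | some i = a})
          ∪ ({x | ∀ j ∈ l, x j ≤ z i}ᶜ ∩ {x | bestOpen x l = a}) := by
      ext x
      by_cases h : ∀ j ∈ l, x j ≤ z i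
      · simp only [weitzmanAction, hm, mem_ofPred_eq, mem_union, mem_inter_iff, mem_compl_iff]
        rw [if_pos h]
        tauto
      · simp only [weitzmanAction, hm, mem_ofPred_eq, mem_union, mem_inter_iff, mem_compl_iff]
        rw [if_neg h]
        tauto
    rw [e]
    exact (hE.inter (MeasurableSet.const _)).union
      (hE.compl.inter (measurableSet_bestOpen l a))

/-- Weitzman's rule, with the order of the boxes given by `m`. -/
noncomputable def weitzmanPolicy (z : Fin n → ℝ) (m : List (Fin n) → Option (Fin n)) :
    Policy n where
  prob l x a := if a = weitzmanAction z m l x then 1 else 0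
  nonneg l x a := by split_ifs <;> norm_num
  sum_eq_one l x := by simp
  measurable l a := by
    refine Measurable.ite ?_ measurable_const measurable_const
    simpa [eq_comm] using measurableSet_weitzmanAction z m l a
  adapted l x y h := by
    have : weitzmanAction z m l x = weitzmanAction z m l y := by
      unfold weitzmanAction
      cases m l with
      | none => exact bestOpen_congr h
      | some i =>
        have : (∀ j ∈ l, x j ≤ z i) ↔ ∀ j ∈ l, y j ≤ z i :=
          forall_congr' fun j => forall_congr' fun hj => by rw [h j hj]
        simp only [this, bestOpen_congr h]
    funext a
    rw [this]

variable {β : ℝ} {z x : Fin n → ℝ}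

/-- Weitzman's rule attains the index value. -/
theorem weitzmanPolicy_amendedFrom (hβ0 : 0 < β) (hβ1 : β ≤ 1)
    (hz : ∀ i, z i ∈ Icc (0 : ℝ) 1) (hx : ∀ i, x i ∈ Icc (0 : ℝ) 1)
    (m : List (Fin n) → Option (Fin n)) (hn : 0 < n)
    (hm0 : ∀ l, m l = none → ∀ i, i ∈ l)
    (hm1 : ∀ l i, m l = some i → i ∉ l ∧ ∀ k, k ∉ l → z k ≤ z i) (k : ℕ) :
    ∀ l : List (Fin n), l.Nodup → n ≤ k + l.length →
      (weitzmanPolicy z m).amendedFrom β z x k l = indexValue β z x l := by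
  -- The action of the rule has no loss at any history: it is the best closed box if nothing seen
  -- beats its reservation value, and a best open box otherwise.
  have hact : ∀ l, ∃ i, weitzmanAction z m l x = some i ∧ gap β z x l i = 0 := by
    intro l
    unfold weitzmanAction
    cases hml : m l with
    | none =>
      have hall := hm0 l hml
      cases hb : bestOpen x l with
      | none =>
        have := hall ⟨0, hn⟩
        rw [bestOpen_eq_none hb] at this
        simp at this
      | some j =>
        obtain ⟨h1, h2⟩ := bestOpen_eq_some hb
        exact ⟨j, rfl, gap_open_eq_zero hβ0 hβ1 hx h1 h2 fun i hi => absurd (hall i) hi⟩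
    | some i =>
      obtain ⟨h1, h2⟩ := hm1 l i hml
      by_cases h : ∀ j ∈ l, x j ≤ z i
      · exact ⟨i, by simp only; rw [if_pos h], gap_closed_eq_zero hβ0 hβ1 hz hx h1 h2 h⟩
      · simp only [if_neg h]
        push Not at h
        obtain ⟨j, hj, hji⟩ := h
        cases hb : bestOpen x l with
        | none =>
          rw [bestOpen_eq_none hb] at hj
          simp at hj
        | some a =>
          obtain ⟨h3, h4⟩ := bestOpen_eq_some hb
          exact ⟨a, rfl, gap_open_eq_zero hβ0 hβ1 hx h3 h4 fun k hk =>
            (h2 k hk).trans (hji.le.trans (h4 j hj))⟩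
  have step : ∀ (k : ℕ) (l : List (Fin n)), (∀ i, i ∉ l →
      (weitzmanPolicy z m).amendedFrom β z x k (i :: l) = indexValue β z x (i :: l)) →
      (weitzmanPolicy z m).amendedFrom β z x (k + 1) l = indexValue β z x l := by
    intro k l h
    obtain ⟨i, hi, hg⟩ := hact l
    have hp : ∀ a, (weitzmanPolicy z m).prob l x a = if a = some i then 1 else 0 := by
      intro a
      show (if a = weitzmanAction z m l x then (1 : ℝ) else 0) = _
      rw [hi]
    refine (sub_eq_zero.1 ?_).symm
    rw [Policy.indexValue_sub_amendedFrom_succ, hp none, if_neg (by simp), zero_mul, zero_add]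
    refine Finset.sum_eq_zero fun j _ => ?_
    rw [hp]
    by_cases hji : j = i
    · subst hji
      rw [if_pos rfl, hg]
      split_ifs with hjl
      · ring
      · rw [h j hjl]; ring
    · rw [if_neg (by simpa using hji), zero_mul]
  induction k with
  | zero =>
    intro l hl hn'
    have hall := mem_of_nodup_of_le_length hl (by simpa using hn')
    rw [Policy.amendedFrom_zero _ hall]
    exact step 0 l fun i hi => absurd (hall i) hi
  | succ k ih =>
    intro l hl hn'
    exact step k l fun i hi => ih _ (List.nodup_cons.2 ⟨hi, hl⟩) (by simp; omega)

theorem exists_next_box (z : Fin n → ℝ) : ∃ m : List (Fin n) → Option (Fin n),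
    (∀ l, m l = none → ∀ i, i ∈ l) ∧
      ∀ l i, m l = some i → i ∉ l ∧ ∀ k, k ∉ l → z k ≤ z i := by
  have h : ∀ l : List (Fin n), ∃ o : Option (Fin n), (o = none → ∀ i, i ∈ l) ∧
      ∀ i, o = some i → i ∉ l ∧ ∀ k, k ∉ l → z k ≤ z i := by
    intro l
    rcases (Finset.univ.filter fun i => i ∉ l).eq_empty_or_nonempty with h | h
    · refine ⟨none, fun _ i => ?_, by simp⟩
      by_contra hi
      have : i ∈ Finset.univ.filter fun i => i ∉ l := by simpa using hi
      rw [h] at this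
      simp at this
    · obtain ⟨i, hi, hmax⟩ := Finset.exists_max_image _ z h
      refine ⟨some i, by simp, fun j hj => ?_⟩
      obtain rfl : i = j := by simpa using hj
      exact ⟨by simpa using hi, fun k hk => hmax k (by simpa using hk)⟩
  choose m hm using h
  exact ⟨m, fun l => (hm l).1, fun l => (hm l).2⟩

end WeitzmanPolicy

/-! ### Expected utility under the amended rewards -/

section Expectation

variable {c β : ℝ} (σ : Fin n → Strategy μ)

/-- The joint law of the values in the boxes. -/
noncomputable abbrev jointLaw (σ : Fin n → Strategy μ) : Measure (Fin n → ℝ) :=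
  Measure.pi fun i => (σ i).law

theorem ae_mem_cube : ∀ᵐ x ∂(jointLaw σ), ∀ i, x i ∈ Icc (0 : ℝ) 1 := by
  rw [ae_all_iff]
  intro i
  exact (measurePreserving_eval (fun i => (σ i).law) i).quasiMeasurePreserving.ae (σ i).ae_mem

theorem integrable_comp_eval {i : Fin n} {f : ℝ → ℝ} (hf : Integrable f (σ i).law) :
    Integrable (fun x : Fin n → ℝ => f (x i)) (jointLaw σ) :=
  (measurePreserving_eval (fun i => (σ i).law) i).integrable_comp_of_integrable hf

theorem Policy.prob_le_one (p : Policy n) (l : List (Fin n)) (x : Fin n → ℝ)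
    (a : Option (Fin n)) : p.prob l x a ≤ 1 := by
  rw [← p.sum_eq_one l x]
  exact Finset.single_le_sum (f := fun a => p.prob l x a) (fun a _ => p.nonneg l x a)
    (Finset.mem_univ a)

theorem Policy.reach_le_one (p : Policy n) (x : Fin n → ℝ) (l : List (Fin n)) :
    p.reach x l ≤ 1 := by
  induction l with
  | nil => exact le_rfl
  | cons i l ih => exact mul_le_one₀ ih (p.nonneg _ _ _) (p.prob_le_one _ _ _)

theorem Policy.measurable_reach (p : Policy n) (l : List (Fin n)) :
    Measurable fun x => p.reach x l := by
  induction l with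
  | nil => exact measurable_const
  | cons i l ih => exact ih.mul (p.measurable l (some i))

theorem Policy.reach_congr (p : Policy n) {l : List (Fin n)} {x y : Fin n → ℝ}
    (h : ∀ i ∈ l, x i = y i) : p.reach x l = p.reach y l := by
  induction l with
  | nil => rfl
  | cons i l ih =>
    have h' : ∀ j ∈ l, x j = y j := fun j hj => h j (List.mem_cons_of_mem _ hj)
    simp only [Policy.reach]
    rw [ih h', p.adapted l x y h']

variable {σ}

theorem Policy.integrable_prob_mul (p : Policy n) (l : List (Fin n)) (a : Option (Fin n))
    {f : (Fin n → ℝ) → ℝ} (hf : Integrable f (jointLaw σ)) :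
    Integrable (fun x => p.prob l x a * f x) (jointLaw σ) :=
  hf.bdd_mul (c := 1) (p.measurable l a).aestronglyMeasurable
    (Filter.Eventually.of_forall fun x => by
      rw [Real.norm_eq_abs, abs_of_nonneg (p.nonneg _ _ _)]; exact p.prob_le_one l x a)

theorem Policy.integrable_reach_mul (p : Policy n) (l : List (Fin n))
    {f : (Fin n → ℝ) → ℝ} (hf : Integrable f (jointLaw σ)) :
    Integrable (fun x => p.reach x l * f x) (jointLaw σ) :=
  hf.bdd_mul (c := 1) (p.measurable_reach l).aestronglyMeasurable
    (Filter.Eventually.of_forall fun x => by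
      rw [Real.norm_eq_abs, abs_of_nonneg (p.reach_nonneg _)]; exact p.reach_le_one x l)

theorem integrable_openingReward (r : ℝ) (F : Strategy μ) :
    Integrable (fun a => openingReward β r a) F.law :=
  (integrable_const _).sub ((F.integrable_excess r).const_mul β)

theorem Policy.integrable_utilityFrom (p : Policy n) (c β : ℝ) (k : ℕ) (l : List (Fin n)) :
    Integrable (fun x => p.utilityFrom c β x k l) (jointLaw σ) := by
  induction k generalizing l with
  | zero =>
    refine integrable_finsetSum _ fun i _ => ?_
    split_ifs
    · exact p.integrable_prob_mul l _ (integrable_comp_eval σ (σ i).integrable_id)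
    · exact integrable_const _
  | succ k ih =>
    refine integrable_finsetSum _ fun i _ => ?_
    split_ifs
    · exact p.integrable_prob_mul l _ (integrable_comp_eval σ (σ i).integrable_id)
    · exact p.integrable_prob_mul l _ ((integrable_const _).add ((ih _).const_mul β))

theorem Policy.integrable_amendedFrom (p : Policy n) (β : ℝ) (z : Fin n → ℝ) (k : ℕ)
    (l : List (Fin n)) : Integrable (fun x => p.amendedFrom β z x k l) (jointLaw σ) := by
  induction k generalizing l with
  | zero =>
    refine integrable_finsetSum _ fun i _ => ?_
    split_ifs
    · exact p.integrable_prob_mul l _ (integrable_comp_eval σ (σ i).integrable_id)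
    · exact integrable_const _
  | succ k ih =>
    refine integrable_finsetSum _ fun i _ => ?_
    split_ifs
    · exact p.integrable_prob_mul l _ (integrable_comp_eval σ (σ i).integrable_id)
    · exact p.integrable_prob_mul l _
        ((integrable_comp_eval σ (integrable_openingReward (z i) (σ i))).add
          ((ih _).const_mul β))

/-- Amending the rewards of opening boxes does not change the expected utility. -/
theorem Policy.integral_reach_mul_utility_sub_amended (p : Policy n) {z : Fin n → ℝ}
    (hmean : ∀ i, ∫ a, openingReward β (z i) a ∂(σ i).law = -c) (k : ℕ) (l : List (Fin n)) :
    ∫ x, p.reach x l * (p.utilityFrom c β x k l - p.amendedFrom β z x k l) ∂(jointLaw σ) = 0 := by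
  induction k generalizing l with
  | zero => simp [Policy.utilityFrom, Policy.amendedFrom]
  | succ k ih =>
    -- For each box opened next, the difference is the error in its reward plus the same difference
    -- one opening later, discounted.
    have e : ∀ x, p.reach x l * (p.utilityFrom c β x (k + 1) l - p.amendedFrom β z x (k + 1) l)
        = ∑ i, if i ∈ l then 0 else
          (p.reach x (i :: l) * (-c - openingReward β (z i) (x i))
            + β * (p.reach x (i :: l) *
              (p.utilityFrom c β x k (i :: l) - p.amendedFrom β z x k (i :: l)))) := by
      intro x
      simp only [Policy.utilityFrom, Policy.amendedFrom, ← Finset.sum_sub_distrib,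
        Finset.mul_sum, Policy.reach]
      refine Finset.sum_congr rfl fun i _ => ?_
      split_ifs <;> ring
    have hr : ∀ i, Integrable (fun x : Fin n → ℝ => -c - openingReward β (z i) (x i))
        (jointLaw σ) := fun i =>
      (integrable_const _).sub (integrable_comp_eval σ (integrable_openingReward (z i) (σ i)))
    have hd : ∀ i, Integrable (fun x => p.reach x (i :: l) *
        (p.utilityFrom c β x k (i :: l) - p.amendedFrom β z x k (i :: l))) (jointLaw σ) := fun i =>
      p.integrable_reach_mul _
        ((p.integrable_utilityFrom c β k _).sub (p.integrable_amendedFrom β z k _))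
    simp only [e]
    rw [integral_finsetSum]
    · refine Finset.sum_eq_zero fun i _ => ?_
      split_ifs with hi
      · simp
      · rw [integral_add (p.integrable_reach_mul _ (hr i)) ((hd i).const_mul β),
          integral_const_mul, ih, mul_zero, add_zero]
        have hmeas : Measurable fun a => openingReward β (z i) a := by
          unfold openingReward; fun_prop
        -- `p.reach x (i :: l)` includes the decision to open `i` but not the value found: it
        -- depends on the coordinates in `l` alone, so it is independent of the reward error, which
        -- has mean `0`.
        rw [integral_pi_mul_of_disjoint (fun i => (σ i).law) l.toFinset {i}
          (by simpa using hi) (fun x => p.reach x (i :: l))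
          (fun x => -c - openingReward β (z i) (x i)) (p.measurable_reach _)
          (measurable_const.sub (hmeas.comp (measurable_pi_apply i)))]
        · have e1 := integral_sub (μ := jointLaw σ) (integrable_const (-c))
            (integrable_comp_eval σ (integrable_openingReward (β := β) (z i) (σ i)))
          rw [integral_comp_eval (μ := fun i => (σ i).law) (i := i)
            (f := fun a => openingReward β (z i) a) hmeas.aestronglyMeasurable, hmean] at e1
          simp only [integral_const, probReal_univ, one_smul, sub_self] at e1
          rw [e1, mul_zero]
        · intro x y hxy
          have h' : ∀ j ∈ l, x j = y j := fun j hj => hxy j (by simpa using hj)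
          simp only [Policy.reach]
          rw [p.reach_congr h', p.adapted l x y h']
        · intro x y hxy
          rw [hxy i (by simp)]
    · intro i _
      split_ifs
      · exact integrable_const _
      · exact (p.integrable_reach_mul _ (hr i)).add ((hd i).const_mul β)

theorem pandoraUtility_eq_amended (p : Policy n) {z : Fin n → ℝ}
    (hmean : ∀ i, ∫ a, openingReward β (z i) a ∂(σ i).law = -c) :
    pandoraUtility c β σ p = ∫ x, p.amendedFrom β z x n [] ∂(jointLaw σ) := by
  have h := p.integral_reach_mul_utility_sub_amended hmean n []
  simp only [Policy.reach, one_mul] at h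
  rw [integral_sub (p.integrable_utilityFrom c β n []) (p.integrable_amendedFrom β z n [])] at h
  exact sub_eq_zero.1 h

end Expectation

/-! ### Optimal policies follow Weitzman's rule almost surely -/

section Optimal

variable {c β : ℝ} {σ : Fin n → Strategy μ}

/-- The policy follows Weitzman's rule at the histories that it reaches when the values are `x`:
it opens only boxes with the largest reservation value among the closed ones, and only while no
larger value has been seen; it selects only boxes with the largest value seen, and only if no
closed box has a larger reservation value; it takes the outside option only after opening all
boxes. -/
structure Policy.Regular (p : Policy n) (z x : Fin n → ℝ) : Prop where
  visit_max : ∀ l : List (Fin n), l.Nodup → 0 < p.reach x l → ∀ i, i ∉ l →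
    0 < p.prob l x (some i) → ∀ k, k ∉ l → z k ≤ z i
  visit_le : ∀ l : List (Fin n), l.Nodup → 0 < p.reach x l → ∀ i, i ∉ l →
    0 < p.prob l x (some i) → ∀ j ∈ l, x j ≤ z i
  select_max : ∀ l : List (Fin n), l.Nodup → 0 < p.reach x l → ∀ j ∈ l,
    0 < p.prob l x (some j) → ∀ k ∈ l, x k ≤ x j
  select_ge : ∀ l : List (Fin n), l.Nodup → 0 < p.reach x l → ∀ j ∈ l,
    0 < p.prob l x (some j) → ∀ k, k ∉ l → z k ≤ x j
  outside : ∀ l : List (Fin n), l.Nodup → 0 < p.reach x l → 0 < p.prob l x none → ∀ i, i ∈ l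

/-- Weitzman's rule dominates `p` pathwise, while optimality bounds its expectation by that of `p`;
so the two agree almost everywhere. -/
theorem ae_amended_eq_of_isOptimal (hn : 0 < n) (hβ0 : 0 < β) (hβ1 : β ≤ 1) {z : Fin n → ℝ}
    (hz : ∀ i, z i ∈ Icc (0 : ℝ) 1)
    (hmean : ∀ i, ∫ a, openingReward β (z i) a ∂(σ i).law = -c)
    {p : Policy n} (hp : IsOptimal c β σ p) :
    ∀ᵐ x ∂(jointLaw σ), p.amendedFrom β z x n [] = indexValue β z x [] := by
  obtain ⟨m, hm0, hm1⟩ := exists_next_box z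
  set q := weitzmanPolicy z m
  have hq : ∀ᵐ x ∂(jointLaw σ), q.amendedFrom β z x n [] = indexValue β z x [] := by
    filter_upwards [ae_mem_cube σ] with x hx
    exact weitzmanPolicy_amendedFrom hβ0 hβ1 hz hx m hn hm0 hm1 n [] List.nodup_nil (by simp)
  have hle : ∀ᵐ x ∂(jointLaw σ), p.amendedFrom β z x n [] ≤ q.amendedFrom β z x n [] := by
    filter_upwards [ae_mem_cube σ, hq] with x hx hqx
    rw [hqx]
    exact p.amendedFrom_le hβ0 hβ1 hz hx n [] List.nodup_nil (by simp)
  have hopt := hp q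
  rw [pandoraUtility_eq_amended q hmean, pandoraUtility_eq_amended p hmean] at hopt
  have hpi := p.integrable_amendedFrom (σ := σ) β z n []
  have hqi := q.integrable_amendedFrom (σ := σ) β z n []
  have heq := (integral_eq_iff_of_ae_le hpi hqi hle).1
    (le_antisymm (integral_mono_ae hpi hqi hle) hopt)
  filter_upwards [heq, hq] with x h1 h2
  exact h1.trans h2

/-- An optimal policy follows Weitzman's rule almost surely. -/
theorem IsOptimal.ae_regular (hn : 0 < n) (hβ0 : 0 < β) (hβ1 : β ≤ 1) (hc : 0 ≤ c)
    (hs : c < β * μ) (hf : 0 < c ∨ β < 1) {p : Policy n} (hp : IsOptimal c β σ p) :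
    ∀ᵐ x ∂(jointLaw σ), p.Regular (fun i => reservationValue c β (σ i)) x := by
  set z : Fin n → ℝ := fun i => reservationValue c β (σ i) with hzdef
  have hz0 : ∀ i, 0 < z i := fun i => reservationValue_pos hβ0 hβ1 hc hs hf (σ i)
  have hz : ∀ i, z i ∈ Icc (0 : ℝ) 1 := fun i =>
    ⟨(hz0 i).le, (reservationValue_lt_one hβ0 hβ1 hc hs hf (σ i)).le⟩
  have hmean : ∀ i, ∫ a, openingReward β (z i) a ∂(σ i).law = -c := by
    intro i
    have h := integral_excess hβ0 hβ1 hc hs hf (σ i)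
    have e := integral_sub (μ := (σ i).law) (integrable_const ((1 - β) * z i))
      (((σ i).integrable_excess (z i)).const_mul β)
    rw [integral_const_mul β, h] at e
    simp only [integral_const, probReal_univ, one_smul] at e
    refine e.trans ?_
    ring
  have hloss : ∀ᵐ x ∂(jointLaw σ), ∀ l : List (Fin n), l.Nodup → 0 < p.reach x l →
      p.prob l x none * indexValue β z x l = 0 ∧ ∀ i, p.prob l x (some i) * gap β z x l i = 0 := by
    filter_upwards [ae_mem_cube σ, ae_amended_eq_of_isOptimal hn hβ0 hβ1 hz hmean hp]
      with x hx he l hl hr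
    exact p.no_loss_of_amendedFrom_eq hβ0 hβ1 hz hx he l hl hr
  -- an action that is a loss whenever the closed boxes turn out well is almost never taken
  have upgrade : ∀ (l : List (Fin n)) (a : Option (Fin n)) (S : Set (Fin n → ℝ)),
      MeasurableSet S → (∀ x y, (∀ i ∈ l, x i = y i) → (x ∈ S ↔ y ∈ S)) → l.Nodup →
      (∀ x : Fin n → ℝ, (∀ i, x i ∈ Icc (0 : ℝ) 1) → x ∈ S → (∀ i, i ∉ l → z i < x i) →
        (p.prob l x none * indexValue β z x l = 0 ∧
          ∀ i, p.prob l x (some i) * gap β z x l i = 0) → p.prob l x a = 0) →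
      ∀ᵐ x ∂(jointLaw σ), 0 < p.reach x l → 0 < p.prob l x a → x ∉ S := by
    intro l a S hS hSl hl h
    -- Reaching `l`, choosing `a` and belonging to `S` depend on opened values only. The event that
    -- every closed box beats its reservation value is independent of them and has positive
    -- probability, so a product that vanishes on it vanishes almost surely.
    have key := ae_eq_zero_of_independent_event (fun i => (σ i).law) l.toFinset
      (fun x => p.reach x l * (p.prob l x a * S.indicator 1 x))
      ((p.measurable_reach l).mul ((p.measurable l a).mul (measurable_one.indicator hS)))
      (fun x => mul_nonneg (p.reach_nonneg l) (mul_nonneg (p.nonneg _ _ _)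
        (indicator_nonneg (by simp) x)))
      (p.integrable_reach_mul l (p.integrable_prob_mul l a
        ((integrable_const (1 : ℝ)).indicator hS)))
      (by
        intro x y hxy
        have h' : ∀ j ∈ l, x j = y j := fun j hj => hxy j (by simpa using hj)
        rw [p.reach_congr h', p.adapted l x y h']
        congr 2
        by_cases hx : x ∈ S
        · rw [indicator_of_mem hx, indicator_of_mem ((hSl x y h').1 hx)]; rfl
        · rw [indicator_of_notMem hx, indicator_of_notMem fun hy => hx ((hSl x y h').2 hy)])
      (fun i => Ioi (z i)) (fun i => measurableSet_Ioi)
      (fun i => measure_Ioi_reservationValue_pos hβ0 hβ1 hc hs hf (σ i)) (by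
        filter_upwards [ae_mem_cube σ, hloss] with x hx hlx hE
        by_cases hxS : x ∈ S
        · rcases (p.reach_nonneg (x := x) l).eq_or_lt with hr | hr
          · rw [← hr, zero_mul]
          · rw [h x hx hxS (fun i hi => hE i (by simpa using hi)) (hlx l hl hr)]
            ring
        · rw [indicator_of_notMem hxS]; ring)
    filter_upwards [key] with x hx hr hpa hxS
    rw [indicator_of_mem hxS] at hx
    simp only [Pi.one_apply, mul_one] at hx
    exact (mul_pos hr hpa).ne' hx
  have c1 : ∀ᵐ x ∂(jointLaw σ), ∀ l : List (Fin n), l.Nodup → ∀ i, i ∉ l → ∀ k, k ∉ l →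
      0 < p.reach x l → 0 < p.prob l x (some i) → z k ≤ z i := by
    simp only [ae_all_iff]
    intro l hl i hi k hk
    by_cases hzk : z k ≤ z i
    · exact Filter.Eventually.of_forall fun x _ _ => hzk
    · rw [not_le] at hzk
      filter_upwards [upgrade l (some i) univ MeasurableSet.univ (by simp) hl
        (fun x hx _ hE hL => (mul_eq_zero.1 (hL.2 i)).resolve_right
          (gap_closed_pos_of_closed hβ0 hβ1 hz hx hi hk hzk (hE i hi) (hE k hk)).ne')]
        with x hx hr hp'
      exact absurd (mem_univ x) (hx hr hp')
  have c2 : ∀ᵐ x ∂(jointLaw σ), ∀ l : List (Fin n), l.Nodup → ∀ i, i ∉ l → ∀ j, j ∈ l →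
      0 < p.reach x l → 0 < p.prob l x (some i) → x j ≤ z i := by
    simp only [ae_all_iff]
    intro l hl i hi j hj
    filter_upwards [upgrade l (some i) {x | z i < x j}
      (measurableSet_lt measurable_const (measurable_pi_apply j))
      (fun x y hxy => by simp only [mem_ofPred_eq, hxy j hj]) hl
      (fun x hx hS hE hL => (mul_eq_zero.1 (hL.2 i)).resolve_right
        (gap_closed_pos_of_open hβ0 hβ1 hz hx hi hj hS (hE i hi)).ne')] with x hx hr hp'
    exact not_lt.1 (hx hr hp')
  have c3 : ∀ᵐ x ∂(jointLaw σ), ∀ l : List (Fin n), l.Nodup → ∀ j, j ∈ l → ∀ k, k ∉ l →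
      0 < p.reach x l → 0 < p.prob l x (some j) → z k ≤ x j := by
    simp only [ae_all_iff]
    intro l hl j hj k hk
    filter_upwards [upgrade l (some j) {x | x j < z k}
      (measurableSet_lt (measurable_pi_apply j) measurable_const)
      (fun x y hxy => by simp only [mem_ofPred_eq, hxy j hj]) hl
      (fun x hx hS hE hL => (mul_eq_zero.1 (hL.2 j)).resolve_right
        (gap_open_pos_of_closed hβ0 hβ1 hz hx hj hk hS (hE k hk)).ne')] with x hx hr hp'
    exact not_lt.1 (hx hr hp')
  have c4 : ∀ᵐ x ∂(jointLaw σ), ∀ l : List (Fin n), l.Nodup → ∀ i, i ∉ l →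
      0 < p.reach x l → 0 < p.prob l x none → False := by
    simp only [ae_all_iff]
    intro l hl i hi
    filter_upwards [upgrade l none univ MeasurableSet.univ (by simp) hl
      (fun x hx _ hE hL => (mul_eq_zero.1 hL.1).resolve_right
        (indexValue_pos hβ0 hβ1 hz hi (hz0 i) (hE i hi)).ne')] with x hx hr hp'
    exact hx hr hp' (mem_univ x)
  filter_upwards [ae_mem_cube σ, hloss, c1, c2, c3, c4] with x hx hL h1 h2 h3 h4
  refine ⟨fun l hl hr i hi hp' k hk => h1 l hl i hi k hk hr hp',
    fun l hl hr i hi hp' j hj => h2 l hl i hi j hj hr hp', fun l hl hr j hj hp' k hk => ?_,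
    fun l hl hr j hj hp' k hk => h3 l hl j hj k hk hr hp', fun l hl hr hp' i => ?_⟩
  -- A comparison of two open boxes involves no closed box, so the loss is strict without the
  -- independence argument.
  · by_contra hlt
    rw [not_le] at hlt
    exact (mul_pos hp' (gap_open_pos_of_open hβ0 hβ1 hx hj hk hlt)).ne' ((hL l hl hr).2 j)
  · by_contra hi
    exact h4 l hl i hi hr hp'

end Optimal

/-! ### Fair shares of the top boxes -/

section Share

/-- No box has a larger value than box `i`. -/
def IsTop (x : Fin n → ℝ) (i : Fin n) : Prop := ∀ k, x k ≤ x i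

open Classical in
/-- The number of boxes with the largest value. -/
noncomputable def topCount (x : Fin n → ℝ) : ℝ := ∑ j, if IsTop x j then 1 else 0

open Classical in
/-- The probability that box `i` is drawn when a box with the largest value is drawn at
random. -/
noncomputable def share (i : Fin n) (x : Fin n → ℝ) : ℝ := if IsTop x i then (topCount x)⁻¹ else 0

theorem topCount_nonneg (x : Fin n → ℝ) : 0 ≤ topCount x :=
  Finset.sum_nonneg fun j _ => by split_ifs <;> norm_num

theorem IsTop.one_le_topCount {x : Fin n → ℝ} {i : Fin n} (h : IsTop x i) : 1 ≤ topCount x := by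
  classical
  have := Finset.single_le_sum (f := fun j => if IsTop x j then (1 : ℝ) else 0)
    (fun j _ => by split_ifs <;> norm_num) (Finset.mem_univ i)
  simp only [if_pos h] at this
  exact this

/-- A mass `q` spread evenly over the top boxes; this form permits term-by-term comparison of sums
once fairness has equated probabilities. -/
theorem topCount_mul_inv {x : Fin n → ℝ} {i : Fin n} (h : IsTop x i) (q : ℝ) :
    (open Classical in ∑ j, if IsTop x j then q * (topCount x)⁻¹ else 0) = q := by
  classical
  have h1 : ∑ j, (if IsTop x j then q * (topCount x)⁻¹ else 0)
      = q * (topCount x)⁻¹ * topCount x := by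
    rw [topCount, Finset.mul_sum]
    exact Finset.sum_congr rfl fun j _ => by split_ifs <;> ring
  rw [h1, mul_assoc, inv_mul_cancel₀ (by linarith [h.one_le_topCount]), mul_one]

theorem share_nonneg (i : Fin n) (x : Fin n → ℝ) : 0 ≤ share i x := by
  unfold share
  split_ifs
  · exact inv_nonneg.2 (topCount_nonneg x)
  · exact le_rfl

theorem share_le_one (i : Fin n) (x : Fin n → ℝ) : share i x ≤ 1 := by
  unfold share
  split_ifs with h
  · exact inv_le_one_of_one_le₀ h.one_le_topCount
  · exact zero_le_one

theorem sum_share (hn : 0 < n) (x : Fin n → ℝ) : ∑ i, share i x = 1 := by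
  classical
  obtain ⟨i, -, hi⟩ := Finset.exists_max_image Finset.univ x ⟨⟨0, hn⟩, Finset.mem_univ _⟩
  have := topCount_mul_inv (x := x) (i := i) (fun k => hi k (Finset.mem_univ k)) 1
  simpa [share] using this

theorem measurableSet_isTop (i : Fin n) : MeasurableSet {x : Fin n → ℝ | IsTop x i} := by
  have : {x : Fin n → ℝ | IsTop x i} = ⋂ k, {x | x k ≤ x i} := by ext x; simp [IsTop]
  rw [this]
  exact MeasurableSet.iInter fun k => measurableSet_le (measurable_pi_apply k)
    (measurable_pi_apply i)

theorem measurable_share (i : Fin n) : Measurable (share i) := by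
  classical
  refine Measurable.ite (measurableSet_isTop i) (Measurable.inv ?_) measurable_const
  exact Finset.measurable_fun_sum _ fun j _ =>
    Measurable.ite (measurableSet_isTop j) measurable_const measurable_const

theorem share_comp_perm (e : Equiv.Perm (Fin n)) (i : Fin n) (x : Fin n → ℝ) :
    share i (x ∘ e) = share (e i) x := by
  classical
  have h : ∀ j, IsTop (x ∘ e) j ↔ IsTop x (e j) := fun j =>
    ⟨fun h k => by simpa using h (e.symm k), fun h k => h (e k)⟩
  have hc : topCount (x ∘ e) = topCount x := by
    unfold topCount
    simp only [h]
    exact Equiv.sum_comp e fun j => if IsTop x j then (1 : ℝ) else 0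
  unfold share
  simp only [h, hc]

open Classical in
/-- The share of a box on the event that no value exceeds `r`. -/
noncomputable def shareBelow (r : ℝ) (i : Fin n) (x : Fin n → ℝ) : ℝ :=
  if ∀ j, x j ≤ r then share i x else 0

theorem shareBelow_nonneg (r : ℝ) (i : Fin n) (x : Fin n → ℝ) : 0 ≤ shareBelow r i x := by
  unfold shareBelow
  split_ifs
  · exact share_nonneg i x
  · exact le_rfl

theorem shareBelow_le_one (r : ℝ) (i : Fin n) (x : Fin n → ℝ) : shareBelow r i x ≤ 1 := by
  unfold shareBelow
  split_ifs
  · exact share_le_one i x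
  · exact zero_le_one

theorem forall_le_eq_pi (r : ℝ) :
    {x : Fin n → ℝ | ∀ j, x j ≤ r} = Set.univ.pi fun _ => Iic r := by
  ext x; simp only [mem_ofPred_eq, mem_univ_pi, mem_Iic]

theorem measurableSet_forall_le (r : ℝ) : MeasurableSet {x : Fin n → ℝ | ∀ j, x j ≤ r} := by
  rw [forall_le_eq_pi]
  exact MeasurableSet.univ_pi fun _ => measurableSet_Iic

theorem measurable_shareBelow (r : ℝ) (i : Fin n) : Measurable (shareBelow r i) := by
  classical
  exact Measurable.ite (measurableSet_forall_le r) (measurable_share i) measurable_const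

theorem integrable_shareBelow (m : Measure (Fin n → ℝ)) [IsProbabilityMeasure m] (r : ℝ)
    (i : Fin n) : Integrable (shareBelow r i) m :=
  Integrable.of_bound (measurable_shareBelow r i).aestronglyMeasurable 1
    (Filter.Eventually.of_forall fun x => by
      rw [Real.norm_eq_abs, abs_of_nonneg (shareBelow_nonneg r i x)]
      exact shareBelow_le_one r i x)

/-- By symmetry, each box has the same expected share. -/
theorem integral_shareBelow (hn : 0 < n) (ν : Measure ℝ) [IsProbabilityMeasure ν] (r : ℝ)
    (i : Fin n) :
    ∫ x, shareBelow r i x ∂(Measure.pi fun _ : Fin n => ν) = ν.real (Iic r) ^ n / n := by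
  classical
  set π := Measure.pi fun _ : Fin n => ν
  -- Swapping coordinates `i` and `j` exchanges the two shares. All shares add up to the indicator
  -- of an event whose probability is an `n`-th power.
  have hsym : ∀ j, ∫ x, shareBelow r j x ∂π = ∫ x, shareBelow r i x ∂π := by
    intro j
    rw [← integral_pi_comp_perm ν (Equiv.swap i j) (shareBelow r j)]
    refine integral_congr_ae (Filter.Eventually.of_forall fun x => ?_)
    show shareBelow r j (x ∘ Equiv.swap i j) = shareBelow r i x
    have h : (∀ k, (x ∘ Equiv.swap i j) k ≤ r) ↔ ∀ k, x k ≤ r :=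
      ⟨fun h k => by simpa using h ((Equiv.swap i j).symm k), fun h k => h _⟩
    unfold shareBelow
    rw [share_comp_perm, Equiv.swap_apply_right]
    simp only [h]
  have hsum : ∑ j, ∫ x, shareBelow r j x ∂π = ν.real (Iic r) ^ n := by
    rw [← integral_finsetSum _ fun j _ => integrable_shareBelow π r j]
    have e : ∀ x : Fin n → ℝ, ∑ j, shareBelow r j x
        = {x : Fin n → ℝ | ∀ j, x j ≤ r}.indicator 1 x := by
      intro x
      by_cases h : ∀ j, x j ≤ r
      · rw [indicator_of_mem (by exact h)]
        simp only [shareBelow, if_pos h, sum_share hn, Pi.one_apply]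
      · rw [indicator_of_notMem (by exact h)]
        simp only [shareBelow, if_neg h, Finset.sum_const_zero]
    simp only [e]
    rw [integral_indicator_one (measurableSet_forall_le r), forall_le_eq_pi, measureReal_def,
      Measure.pi_pi, ENNReal.toReal_prod]
    simp [measureReal_def]
  simp only [hsym, Finset.sum_const, Finset.card_univ, Fintype.card_fin, nsmul_eq_mul] at hsum
  have : (n : ℝ) ≠ 0 := by positivity
  field_simp
  linarith

end Share

/-! ### Selection probabilities under regular fair policies -/

section Selection

variable {x : Fin n → ℝ}

theorem Policy.selectFrom_zero (p : Policy n) (i : Fin n) {l : List (Fin n)} (h : ∀ j, j ∈ l) :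
    p.selectFrom i x 0 l = p.selectFrom i x 1 l := by
  simp [Policy.selectFrom, h]

theorem Policy.selectFrom_succ (p : Policy n) (i : Fin n) (k : ℕ) (l : List (Fin n)) :
    p.selectFrom i x (k + 1) l = ∑ j, if j ∈ l then p.prob l x (some j) * (if j = i then 1 else 0)
      else p.prob l x (some j) * p.selectFrom i x k (j :: l) := rfl

theorem Policy.selectFrom_nonneg (p : Policy n) (i : Fin n) (k : ℕ) (l : List (Fin n)) :
    0 ≤ p.selectFrom i x k l := by
  induction k generalizing l with
  | zero =>
    refine Finset.sum_nonneg fun j _ => ?_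
    split_ifs
    all_goals first
      | exact le_rfl
      | exact mul_nonneg (p.nonneg _ _ _) (by norm_num)
  | succ k ih =>
    rw [p.selectFrom_succ]
    refine Finset.sum_nonneg fun j _ => ?_
    split_ifs
    all_goals first
      | exact mul_nonneg (p.nonneg _ _ _) (ih _)
      | exact mul_nonneg (p.nonneg _ _ _) (by norm_num)

theorem Policy.sum_prob_some_le_one (p : Policy n) (l : List (Fin n)) (x : Fin n → ℝ) :
    ∑ j, p.prob l x (some j) ≤ 1 := by
  linarith [p.prob_none_add l x, p.nonneg l x none]

theorem Policy.sum_selectFrom_le_one (p : Policy n) (k : ℕ) (l : List (Fin n)) :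
    ∑ i, p.selectFrom i x k l ≤ 1 := by
  induction k generalizing l with
  | zero =>
    refine le_trans ?_ (p.sum_prob_some_le_one l x)
    simp only [Policy.selectFrom]
    rw [Finset.sum_comm]
    refine Finset.sum_le_sum fun j _ => ?_
    split_ifs
    · rw [← Finset.mul_sum]; simp
    · simpa using p.nonneg l x (some j)
  | succ k ih =>
    refine le_trans ?_ (p.sum_prob_some_le_one l x)
    simp only [Policy.selectFrom]
    rw [Finset.sum_comm]
    refine Finset.sum_le_sum fun j _ => ?_
    split_ifs
    · rw [← Finset.mul_sum]; simp
    · rw [← Finset.mul_sum]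
      exact mul_le_of_le_one_right (p.nonneg _ _ _) (ih _)

theorem Policy.measurable_selectFrom (p : Policy n) (i : Fin n) (k : ℕ) (l : List (Fin n)) :
    Measurable fun x => p.selectFrom i x k l := by
  induction k generalizing l with
  | zero =>
    refine Finset.measurable_fun_sum _ fun j _ => ?_
    by_cases h : j ∈ l
    · simp only [h, if_true]; exact (p.measurable _ _).mul measurable_const
    · simp only [h, if_false]; exact measurable_const
  | succ k ih =>
    refine Finset.measurable_fun_sum _ fun j _ => ?_
    by_cases h : j ∈ l
    · simp only [h, if_true]; exact (p.measurable _ _).mul measurable_const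
    · simp only [h, if_false]; exact (p.measurable _ _).mul (ih _)

theorem Policy.selectFrom_le_one (p : Policy n) (i : Fin n) (k : ℕ) (l : List (Fin n)) :
    p.selectFrom i x k l ≤ 1 :=
  (Finset.single_le_sum (f := fun i => p.selectFrom i x k l)
    (fun j _ => p.selectFrom_nonneg j k l) (Finset.mem_univ i)).trans (p.sum_selectFrom_le_one k l)

theorem Policy.integrable_selectFrom (p : Policy n) (m : Measure (Fin n → ℝ))
    [IsProbabilityMeasure m] (i : Fin n) (k : ℕ) (l : List (Fin n)) :
    Integrable (fun x => p.selectFrom i x k l) m :=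
  Integrable.of_bound (p.measurable_selectFrom i k l).aestronglyMeasurable 1
    (Filter.Eventually.of_forall fun x => by
      rw [Real.norm_eq_abs, abs_of_nonneg (p.selectFrom_nonneg i k l)]
      exact p.selectFrom_le_one i k l)

theorem Policy.prob_eq_one (p : Policy n) {l : List (Fin n)} {i : Fin n}
    (h0 : p.prob l x none = 0) (h : ∀ j, j ≠ i → p.prob l x (some j) = 0) :
    p.prob l x (some i) = 1 := by
  have := p.prob_none_add l x
  rw [h0, zero_add, Finset.sum_eq_single i (fun j _ hj => h j hj) (by simp)] at this
  exact this

theorem Policy.selectFrom_eq_one (p : Policy n) {l : List (Fin n)} {i : Fin n} (hi : i ∈ l)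
    (h : p.prob l x (some i) = 1) (k : ℕ) : p.selectFrom i x k l = 1 := by
  refine le_antisymm (p.selectFrom_le_one i k l) ?_
  cases k with
  | zero =>
    have := Finset.single_le_sum (f := fun j => if j ∈ l then
      p.prob l x (some j) * (if j = i then (1 : ℝ) else 0) else 0) (fun j _ => by
        show 0 ≤ ite _ _ _
        split_ifs
        all_goals first
          | exact le_rfl
          | exact mul_nonneg (p.nonneg _ _ _) (by norm_num)) (Finset.mem_univ i)
    refine le_trans (le_of_eq ?_) this
    simp [hi, h]
  | succ k =>
    have := Finset.single_le_sum (f := fun j => if j ∈ l then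
      p.prob l x (some j) * (if j = i then (1 : ℝ) else 0)
      else p.prob l x (some j) * p.selectFrom i x k (j :: l)) (fun j _ => by
        show 0 ≤ ite _ _ _
        split_ifs
        all_goals first
          | exact mul_nonneg (p.nonneg _ _ _) (p.selectFrom_nonneg _ _ _)
          | exact mul_nonneg (p.nonneg _ _ _) (by norm_num)) (Finset.mem_univ i)
    rw [p.selectFrom_succ]
    simpa [hi, h] using this

theorem Policy.prob_eq_zero_of_not_pos (p : Policy n) {l : List (Fin n)} {a : Option (Fin n)}
    (h : ¬ 0 < p.prob l x a) : p.prob l x a = 0 :=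
  le_antisymm (not_lt.1 h) (p.nonneg l x a)

variable {c β : ℝ} {σ : Fin n → Strategy μ} {p : Policy n} {z : Fin n → ℝ}

/-- A box with the largest value, which the searcher does not pass over unopened, is selected with
at least its share. -/
theorem Policy.Regular.le_selectFrom (hreg : p.Regular z x) (hfair : IsFair c β σ p) {i : Fin n}
    (h0 : 0 ≤ x i) (htop : IsTop x i) (hz : ∀ j, j ≠ i → x j < z i) (k : ℕ) :
    ∀ l : List (Fin n), l.Nodup → 0 < p.reach x l → n ≤ k + l.length →
      (topCount x)⁻¹ ≤ p.selectFrom i x k l := by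
  classical
  have hN : 0 ≤ (topCount x)⁻¹ := inv_nonneg.2 (topCount_nonneg x)
  have step : ∀ (k : ℕ) (l : List (Fin n)), l.Nodup → 0 < p.reach x l →
      (∀ j, j ∉ l → 0 < p.prob l x (some j) → (topCount x)⁻¹ ≤ p.selectFrom i x k (j :: l)) →
      (topCount x)⁻¹ ≤ p.selectFrom i x (k + 1) l := by
    intro k l hl hr h
    have h' : ∀ j, j ∉ l → p.prob l x (some j) * (topCount x)⁻¹
        ≤ p.prob l x (some j) * p.selectFrom i x k (j :: l) := by
      intro j hj
      rcases (p.nonneg l x (some j)).eq_or_lt with hp | hp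
      · rw [← hp]; simp
      · exact mul_le_mul_of_nonneg_left (h j hj hp) hp.le
    have htot : p.prob l x none = 0 → ∑ j, p.prob l x (some j) * (topCount x)⁻¹
        = (topCount x)⁻¹ := by
      intro hnone
      have := p.prob_none_add l x
      rw [hnone, zero_add] at this
      rw [← Finset.sum_mul, this, one_mul]
    rw [p.selectFrom_succ]
    by_cases hi : i ∈ l
    · have hmem : i ∈ maxOpen x l := ⟨hi, h0, fun j _ => htop j⟩
      -- The probability of selecting `i` is spread over all top boxes, to be compared termwise with
      -- `p.prob l x (some j) * (topCount x)⁻¹`: an open box selected with positive probability is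
      -- top, and fairness then equates its probability with that of `i`.
      have e : ∑ j, (if j ∈ l then p.prob l x (some j) * (if j = i then 1 else 0)
          else p.prob l x (some j) * p.selectFrom i x k (j :: l))
          = ∑ j, ((if IsTop x j then p.prob l x (some i) * (topCount x)⁻¹ else 0) +
            if j ∈ l then 0 else p.prob l x (some j) * p.selectFrom i x k (j :: l)) := by
        rw [Finset.sum_add_distrib, topCount_mul_inv htop]
        have e1 : p.prob l x (some i) = ∑ j, if j = i then p.prob l x (some i) else 0 := by simp
        rw [e1, ← Finset.sum_add_distrib]
        refine Finset.sum_congr rfl fun j _ => ?_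
        by_cases hji : j = i
        · subst hji; simp [hi]
        · by_cases hjl : j ∈ l <;> simp [hji, hjl]
      rw [e]
      refine (htot (hfair.outside l x ⟨i, hmem⟩)).ge.trans ?_
      refine Finset.sum_le_sum fun j _ => ?_
      by_cases hjl : j ∈ l
      · rw [if_pos hjl, add_zero]
        by_cases hp : 0 < p.prob l x (some j)
        · have hij : x i ≤ x j := hreg.select_max l hl hr j hjl hp i hi
          have hjtop : IsTop x j := fun k => (htop k).trans hij
          rw [if_pos hjtop, hfair.select l x j ⟨hjl, h0.trans hij, fun k _ => hjtop k⟩ i hmem]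
        · rw [p.prob_eq_zero_of_not_pos hp, zero_mul]
          split_ifs
          · exact mul_nonneg (p.nonneg _ _ _) hN
          · exact le_rfl
      · rw [if_neg hjl]
        have : 0 ≤ if IsTop x j then p.prob l x (some i) * (topCount x)⁻¹ else 0 := by
          split_ifs
          · exact mul_nonneg (p.nonneg _ _ _) hN
          · exact le_rfl
        linarith [h' j hjl]
    · have hnone : p.prob l x none = 0 :=
        p.prob_eq_zero_of_not_pos fun hp => hi (hreg.outside l hl hr hp i)
      refine (htot hnone).ge.trans ?_
      refine Finset.sum_le_sum fun j _ => ?_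
      by_cases hjl : j ∈ l
      -- While `i` is closed no open box is selected, since its value is below `z i`.
      · have hp : p.prob l x (some j) = 0 := p.prob_eq_zero_of_not_pos fun hp =>
          absurd (hreg.select_ge l hl hr j hjl hp i hi)
            (not_le.2 (hz j fun e => hi (e ▸ hjl)))
        rw [if_pos hjl, hp]
        simp
      · rw [if_neg hjl]
        exact h' j hjl
  induction k with
  | zero =>
    intro l hl hr hn
    have hall := mem_of_nodup_of_le_length hl (by simpa using hn)
    rw [p.selectFrom_zero i hall]
    exact step 0 l hl hr fun j hj => absurd (hall j) hj
  | succ k ih =>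
    intro l hl hr hn
    exact step k l hl hr fun j hj hp => ih _ (List.nodup_cons.2 ⟨hj, hl⟩) (mul_pos hr hp)
      (by simp; omega)

/-- A box that is opened first and whose value exceeds all other reservation values is
selected. -/
theorem Policy.Regular.selectFrom_eq_one_of_first (hreg : p.Regular z x) (hn : 2 ≤ n)
    {i : Fin n} (hz : ∀ j, j ≠ i → z j < z i) (hx : ∀ j, j ≠ i → z j < x i) :
    p.selectFrom i x n [] = 1 := by
  have hr0 : 0 < p.reach x [] := zero_lt_one
  have h1 : p.prob [] x (some i) = 1 := by
    refine p.prob_eq_one (p.prob_eq_zero_of_not_pos fun hp => ?_) fun j hj =>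
      p.prob_eq_zero_of_not_pos fun hp => ?_
    · exact absurd (hreg.outside [] List.nodup_nil hr0 hp i) (by simp)
    · exact absurd (hreg.visit_max [] List.nodup_nil hr0 j (by simp) hp i (by simp))
        (not_le.2 (hz j hj))
  have hl : [i].Nodup := List.nodup_singleton i
  have hr1 : 0 < p.reach x [i] := by simp [Policy.reach, h1]
  have h2 : p.prob [i] x (some i) = 1 := by
    refine p.prob_eq_one (p.prob_eq_zero_of_not_pos fun hp => ?_) fun j hj =>
      p.prob_eq_zero_of_not_pos fun hp => ?_
    · obtain ⟨j, hj⟩ : ∃ j : Fin n, j ≠ i := by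
        have : Nontrivial (Fin n) := Fin.nontrivial_iff_two_le.2 hn
        exact exists_ne i
      exact absurd (hreg.outside [i] hl hr1 hp j) (by simpa using hj)
    · exact absurd (hreg.visit_le [i] hl hr1 j (by simpa using hj) hp i (by simp))
        (not_le.2 (hx j hj))
  obtain ⟨k, rfl⟩ : ∃ k, n = k + 1 := ⟨n - 1, by omega⟩
  refine le_antisymm (p.selectFrom_le_one _ _ _) ?_
  rw [p.selectFrom_succ]
  refine le_trans ?_ (Finset.single_le_sum (fun j _ => ?_) (Finset.mem_univ i))
  · simp [h1, p.selectFrom_eq_one (by simp) h2]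
  · simpa using mul_nonneg (p.nonneg _ _ _) (p.selectFrom_nonneg _ _ _)

/-- When all reservation values agree and all values are `0` or `1`, each box is selected with at
least its share. -/
theorem Policy.Regular.share_le_selectFrom_of_zero_one (hfair : IsFair c β σ p)
    (hreg : p.Regular (fun i => reservationValue c β (σ i)) x) {r : ℝ} (hr0 : 0 < r) (hr1 : r < 1)
    (hz : ∀ i, reservationValue c β (σ i) = r) (hx : ∀ i, x i = 0 ∨ x i = 1) (i : Fin n) :
    share i x ≤ p.selectFrom i x n [] := by
  classical
  unfold share
  split_ifs with htop
  swap
  · exact p.selectFrom_nonneg _ _ _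
  rcases hx i with hi | hi
  · refine hreg.le_selectFrom hfair hi.ge htop (fun j _ => ?_) n [] List.nodup_nil zero_lt_one
      (by simp)
    rw [hz]
    exact lt_of_le_of_lt ((htop j).trans hi.le) hr0
  have hN : 0 ≤ (topCount x)⁻¹ := inv_nonneg.2 (topCount_nonneg x)
  -- The first `1` ends the search: it exceeds the common reservation value, and the boxes opened
  -- before are worth `0`.
  have hfirst : ∀ (k : ℕ) (l : List (Fin n)), i ∉ l → l.Nodup → (∀ j ∈ l, x j = 0) →
      0 < p.reach x (i :: l) → p.selectFrom i x k (i :: l) = 1 := by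
    intro k l hil hl hl0 hr
    have hnd := List.nodup_cons.2 ⟨hil, hl⟩
    refine p.selectFrom_eq_one (by simp) (p.prob_eq_one (hfair.outside _ x ⟨i, ?_⟩) fun j hj =>
      p.prob_eq_zero_of_not_pos fun hp => ?_) k
    · exact ⟨by simp, by rw [hi]; exact zero_le_one, fun j _ => htop j⟩
    · by_cases hjl : j ∈ l
      · have := hreg.select_max _ hnd hr j (List.mem_cons_of_mem _ hjl) hp i (by simp)
        rw [hl0 j hjl, hi] at this
        linarith
      · have := hreg.visit_le _ hnd hr j (by simp [hj, hjl]) hp i (by simp)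
        simp only [hz, hi] at this
        linarith
  -- As long as only zeros are open, the search continues, and fairness opens each closed box with
  -- the same probability `q`.
  have main : ∀ (k : ℕ) (l : List (Fin n)), l.Nodup → 0 < p.reach x l → n ≤ k + l.length →
      (∀ j ∈ l, x j = 0) → (topCount x)⁻¹ ≤ p.selectFrom i x k l := by
    intro k
    induction k with
    | zero =>
      intro l hl _ hn hl0
      have := hl0 i (mem_of_nodup_of_le_length hl (by simpa using hn) i)
      rw [hi] at this
      norm_num at this
    | succ k ih =>
      intro l hl hr hn hl0
      have hil : i ∉ l := fun h => by
        have := hl0 i h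
        rw [hi] at this
        norm_num at this
      have hnone : p.prob l x none = 0 :=
        p.prob_eq_zero_of_not_pos fun hp => hil (hreg.outside l hl hr hp i)
      have hopen : ∀ j ∈ l, p.prob l x (some j) = 0 := by
        refine fun j hj => p.prob_eq_zero_of_not_pos fun hp => ?_
        have := hreg.select_ge l hl hr j hj hp i hil
        simp only [hz, hl0 j hj] at this
        linarith
      have hcl : ∀ j, j ∉ l → j ∈ maxClosed c β σ l := fun j hj =>
        ⟨hj, fun m _ => by rw [hz, hz]⟩
      have heq : ∀ j, j ∉ l → p.prob l x (some j) = p.prob l x (some i) := fun j hj =>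
        hfair.visit l x j (hcl j hj) i (hcl i hil)
      set q := p.prob l x (some i) with hq
      have hq0 : 0 ≤ q := p.nonneg _ _ _
      have htot := p.prob_none_add l x
      rw [hnone, zero_add] at htot
      have hqpos : 0 < q := by
        refine lt_of_le_of_ne hq0 fun e => ?_
        have : ∑ j, p.prob l x (some j) = 0 := Finset.sum_eq_zero fun j _ => by
          by_cases hj : j ∈ l
          · exact hopen j hj
          · rw [heq j hj, ← e]
        linarith
      -- All top boxes are still closed. The summand is `q` for `i`, `0` for any other top box and
      -- for open boxes, and `q * (topCount x)⁻¹` for a closed box worth `0`, where the induction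
      -- hypothesis applies.
      have e : (topCount x)⁻¹ = ∑ j, (p.prob l x (some j) * (topCount x)⁻¹
          + (if j = i then q else 0) - if IsTop x j then q * (topCount x)⁻¹ else 0) := by
        rw [Finset.sum_sub_distrib, Finset.sum_add_distrib, topCount_mul_inv htop,
          ← Finset.sum_mul, htot]
        simp
      rw [e, p.selectFrom_succ]
      refine Finset.sum_le_sum fun j _ => ?_
      by_cases hjl : j ∈ l
      · have hji : j ≠ i := fun e => hil (e ▸ hjl)
        have : ¬ IsTop x j := fun h => by
          have := h i
          rw [hl0 j hjl, hi] at this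
          linarith
        simp [hjl, hji, hopen j hjl, this]
      · rw [if_neg hjl, heq j hjl]
        have hr' : 0 < p.reach x (j :: l) := mul_pos hr (by rw [heq j hjl]; exact hqpos)
        by_cases hji : j = i
        · subst hji
          rw [hfirst k l hjl hl hl0 hr']
          simp [htop]
        · rcases hx j with hj | hj
          · have : ¬ IsTop x j := fun h => by
              have := h i
              rw [hj, hi] at this
              linarith
            have hih := ih (j :: l) (List.nodup_cons.2 ⟨hjl, hl⟩) hr' (by simp; omega)
              (fun m hm => by
                rcases List.mem_cons.1 hm with rfl | hm
                · exact hj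
                · exact hl0 m hm)
            simpa [hji, this] using mul_le_mul_of_nonneg_left hih hq0
          · have : IsTop x j := fun m => by rw [hj, ← hi]; exact htop m
            simpa [hji, this] using mul_nonneg hq0 (p.selectFrom_nonneg i k (j :: l))
  exact main n [] List.nodup_nil zero_lt_one (by simp) (by simp)

end Selection

/-! ### Payoff bounds and the two profitable deviations -/

section Payoffs

variable {c β : ℝ}

theorem sum_boxPayoff_le_one (σ : Fin n → Strategy μ) (p : Policy n) :
    ∑ i, boxPayoff σ p i ≤ 1 := by
  unfold boxPayoff
  rw [← integral_finsetSum _ fun i _ => p.integrable_selectFrom _ i n []]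
  refine (integral_mono (integrable_finsetSum _ fun i _ => p.integrable_selectFrom _ i n [])
    (integrable_const 1) fun x => p.sum_selectFrom_le_one n []).trans ?_
  simp

theorem exists_boxPayoff_le (hn : 0 < n) (σ : Fin n → Strategy μ) (p : Policy n) :
    ∃ i, boxPayoff σ p i ≤ 1 / n := by
  by_contra! h
  have h1 : ∑ _i : Fin n, (1 / n : ℝ) < ∑ i, boxPayoff σ p i :=
    Finset.sum_lt_sum_of_nonempty ⟨⟨0, hn⟩, Finset.mem_univ _⟩ fun i _ => h i
  have h2 := sum_boxPayoff_le_one σ p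
  have hn' : (n : ℝ) ≠ 0 := by positivity
  simp only [Finset.sum_const, Finset.card_univ, Fintype.card_fin, nsmul_eq_mul] at h1
  rw [mul_one_div_cancel hn'] at h1
  linarith

/-- With `n = m + 1`, Bernoulli's inequality `1 - m * a ≤ (1 - a) ^ m` leaves a surplus of at least
`m * a ^ 2 / n`. -/
theorem add_pow_div_gt {a : ℝ} (ha0 : 0 < a) (ha1 : a ≤ 1) (hn : 2 ≤ n) :
    1 / (n : ℝ) < a + (1 - a) ^ n / n := by
  obtain ⟨m, rfl⟩ : ∃ m, n = m + 1 := ⟨n - 1, by omega⟩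
  have hm : (1 : ℝ) ≤ m := by exact_mod_cast (by omega : 1 ≤ m)
  have h := one_add_mul_le_pow (a := -a) (by linarith) m
  have h2 : (1 - a) * (1 + m * -a) ≤ (1 - a) ^ (m + 1) := by
    rw [pow_succ']
    exact mul_le_mul_of_nonneg_left (by simpa [sub_eq_add_neg] using h) (by linarith)
  have hpos : (0 : ℝ) < (m + 1 : ℕ) := by positivity
  rw [div_lt_iff₀ hpos, add_mul, div_mul_cancel₀ _ hpos.ne']
  push_cast
  nlinarith [mul_pos ha0 ha0]

/-- The payoff of a box that is visited first because of a slightly larger reservation value. -/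
theorem le_boxPayoff_update (hn : 2 ≤ n) (hβ0 : 0 < β) (hβ1 : β ≤ 1) (hc : 0 ≤ c)
    (hs : c < β * μ) (hf : 0 < c ∨ β < 1) {F G : Strategy μ} {i : Fin n} {p : Policy n}
    (hlt : reservationValue c β F < reservationValue c β G)
    (hopt : IsOptimal c β (Function.update (fun _ => F) i G) p)
    (hfair : IsFair c β (Function.update (fun _ => F) i G) p)
    (κ : Measure ℝ) [IsProbabilityMeasure κ] {t : ℝ} (ht0 : 0 ≤ t) (ht1 : t ≤ 1)
    (hG : G.law = ENNReal.ofReal (1 - t) • F.law + ENNReal.ofReal t • κ) :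
    (1 - t) * (F.law.real (Ioi (reservationValue c β F))
      + (1 - F.law.real (Ioi (reservationValue c β F))) ^ n / n)
      ≤ boxPayoff (Function.update (fun _ => F) i G) p i := by
  set r := reservationValue c β F with hr
  set σ : Fin n → Strategy μ := Function.update (fun _ => F) i G with hσ
  have hσi : σ i = G := Function.update_self ..
  have hσj : ∀ j, j ≠ i → σ j = F := fun j hj => Function.update_of_ne hj ..
  -- A lower bound for the selection of the deviator: certain above `r`, its share if no value
  -- exceeds `r`. The event that only other boxes exceed `r` is given up.
  set f : (Fin n → ℝ) → ℝ := fun x => (Ioi r).indicator 1 (x i) + shareBelow r i x with hfdef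
  have hf1 : ∀ x, r < x i → f x = 1 := by
    intro x hx
    have : ¬ ∀ j, x j ≤ r := fun h => absurd (h i) (not_le.2 hx)
    simp only [hfdef, shareBelow, if_neg this]
    rw [indicator_of_mem (mem_Ioi.2 hx)]
    simp
  have hf2 : ∀ x, x i ≤ r → f x = shareBelow r i x := by
    intro x hx
    simp only [hfdef]
    rw [indicator_of_notMem (notMem_Ioi.2 hx), zero_add]
  have hf0 : ∀ x, 0 ≤ f x := fun x =>
    add_nonneg (indicator_nonneg (by simp) _) (shareBelow_nonneg _ _ _)
  have hfle : ∀ x, f x ≤ 1 := by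
    intro x
    rcases le_or_gt (x i) r with h | h
    · rw [hf2 x h]; exact shareBelow_le_one _ _ _
    · rw [hf1 x h]
  have hind : Measurable fun x : Fin n → ℝ => (Ioi r).indicator (1 : ℝ → ℝ) (x i) :=
    (measurable_one.indicator measurableSet_Ioi).comp (measurable_pi_apply i)
  have hfm : Measurable f := hind.add (measurable_shareBelow r i)
  have hlow : ∀ᵐ x ∂(jointLaw σ), f x ≤ p.selectFrom i x n [] := by
    filter_upwards [ae_mem_cube σ, hopt.ae_regular (by omega) hβ0 hβ1 hc hs hf] with x hx hreg
    rcases le_or_gt (x i) r with h | h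
    · rw [hf2 x h]
      unfold shareBelow share
      split_ifs with h1 h2
      · refine hreg.le_selectFrom hfair (hx i).1 h2 (fun j _ => ?_) n [] List.nodup_nil
          zero_lt_one (by simp)
        simp only [hσi]
        exact (h1 j).trans_lt hlt
      · exact p.selectFrom_nonneg _ _ _
      · exact p.selectFrom_nonneg _ _ _
    · rw [hreg.selectFrom_eq_one_of_first hn (i := i)
        (fun j hj => by simp only [hσi, hσj j hj]; exact hlt)
        (fun j hj => by simp only [hσj j hj]; exact h)]
      exact hfle x
  have hfi : Integrable f (jointLaw σ) :=
    Integrable.of_bound hfm.aestronglyMeasurable 1 (Filter.Eventually.of_forall fun x => by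
      rw [Real.norm_eq_abs, abs_of_nonneg (hf0 x)]; exact hfle x)
  refine le_trans ?_ (integral_mono_ae hfi (p.integrable_selectFrom _ i n []) hlow)
  -- At the price of a factor `1 - t` the law of the deviator is replaced by `F` too; the values are
  -- then i.i.d. and the symmetric formula for shares applies.
  refine le_trans (le_of_eq ?_) (integral_pi_update_ge (fun _ : Fin n => F.law) i G.law κ t ht0 ht1
    hG f hfm hf0 hfle (fun j => (σ j).law) (by
      funext j
      by_cases hj : j = i
      · subst hj; rw [hσi, Function.update_self]
      · rw [hσj j hj, Function.update_of_ne hj]))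
  congr 1
  rw [integral_add (Integrable.of_bound hind.aestronglyMeasurable 1
      (Filter.Eventually.of_forall fun x => by
        unfold Set.indicator; split_ifs <;> simp)) (integrable_shareBelow _ r i),
    integral_shareBelow (by omega), integral_comp_eval (μ := fun _ : Fin n => F.law) (i := i)
      (f := (Ioi r).indicator (1 : ℝ → ℝ))
      (measurable_one.indicator measurableSet_Ioi).aestronglyMeasurable,
    integral_indicator_one measurableSet_Ioi]
  have hcompl : F.law.real (Iic r) = 1 - F.law.real (Ioi r) := by
    rw [← compl_Ioi, probReal_compl_eq_one_sub measurableSet_Ioi]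
  rw [hcompl]

/-- When all boxes are fully revealing, each is selected with probability at most `1 / n`. -/
theorem boxPayoff_fullyRevealing_le (hn : 0 < n) (hβ0 : 0 < β) (hβ1 : β ≤ 1) (hc : 0 ≤ c)
    (hs : c < β * μ) (hf : 0 < c ∨ β < 1) (h0 : 0 ≤ μ) (h1 : μ ≤ 1) {p : Policy n}
    (hopt : IsOptimal c β (fun _ => fullyRevealing μ h0 h1) p)
    (hfair : IsFair c β (fun _ => fullyRevealing μ h0 h1) p) (i : Fin n) :
    boxPayoff (fun _ => fullyRevealing μ h0 h1) p i ≤ 1 / n := by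
  set F := fullyRevealing μ h0 h1 with hF
  set σ : Fin n → Strategy μ := fun _ => F
  have hzo : ∀ᵐ x ∂(jointLaw σ), ∀ i, x i = 0 ∨ x i = 1 := by
    rw [ae_all_iff]
    intro j
    have hae : ∀ᵐ a ∂F.law, a = 0 ∨ a = 1 := by
      rw [ae_iff]
      have hm : MeasurableSet {a : ℝ | ¬ (a = 0 ∨ a = 1)} :=
        ((measurableSet_singleton 0).union (measurableSet_singleton 1)).compl
      simp only [hF, fullyRevealing, Measure.add_apply, Measure.smul_apply]
      rw [Measure.dirac_apply' _ hm, Measure.dirac_apply' _ hm]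
      simp
    exact (measurePreserving_eval (fun i => (σ i).law) j).quasiMeasurePreserving.ae hae
  have hle : ∀ᵐ x ∂(jointLaw σ), p.selectFrom i x n [] ≤ shareBelow 1 i x := by
    filter_upwards [ae_mem_cube σ, hzo, hopt.ae_regular hn hβ0 hβ1 hc hs hf] with x hx hx01 hreg
    have hsh : ∀ j, share j x ≤ p.selectFrom j x n [] := fun j =>
      hreg.share_le_selectFrom_of_zero_one hfair
        (reservationValue_pos hβ0 hβ1 hc hs hf F) (reservationValue_lt_one hβ0 hβ1 hc hs hf F)
        (fun _ => rfl) hx01 j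
    have e : shareBelow 1 i x = share i x := if_pos fun j => (hx j).2
    rw [e]
    have s1 := sum_share hn x
    have s2 := p.sum_selectFrom_le_one (x := x) n []
    -- Shares sum to `1`, selection probabilities to at most `1`, and every other box gets at least
    -- its share; so box `i` gets no more than its own.
    rw [← Finset.add_sum_erase _ _ (Finset.mem_univ i)] at s1 s2
    have s3 : ∑ j ∈ Finset.univ.erase i, share j x
        ≤ ∑ j ∈ Finset.univ.erase i, p.selectFrom j x n [] :=
      Finset.sum_le_sum fun j _ => hsh j
    linarith
  refine (integral_mono_ae (p.integrable_selectFrom _ i n [])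
    (integrable_shareBelow _ 1 i) hle).trans (le_of_eq ?_)
  have hint := integral_shareBelow hn F.law 1 i
  have hone : F.law.real (Iic 1) = 1 := by
    have h : F.law (Iic 1)ᶜ = 0 :=
      measure_mono_null (compl_subset_compl.2 Icc_subset_Iic_self) F.support
    rw [measureReal_def, (prob_compl_eq_zero_iff measurableSet_Iic).1 h, ENNReal.toReal_one]
  rw [hone, one_pow] at hint
  exact hint

/-- The payoff of an uninformative box among fully revealing ones. -/
theorem pow_le_boxPayoff_uninformative (hn : 0 < n) (hβ0 : 0 < β) (hβ1 : β ≤ 1) (hc : 0 ≤ c)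
    (hs : c < β * μ) (hf : 0 < c ∨ β < 1) (h0 : 0 < μ) (h1 : μ ≤ 1) {i : Fin n} {p : Policy n}
    {F U : Strategy μ} (hF : F = fullyRevealing μ h0.le h1) (hU : U = uninformative μ h0.le h1)
    (hopt : IsOptimal c β (Function.update (fun _ => F) i U) p)
    (hfair : IsFair c β (Function.update (fun _ => F) i U) p) :
    (1 - μ) ^ (n - 1) ≤ boxPayoff (Function.update (fun _ => F) i U) p i := by
  set σ : Fin n → Strategy μ := Function.update (fun _ => F) i U with hσ
  have hσi : σ i = U := Function.update_self ..
  have hσj : ∀ j, j ≠ i → σ j = F := fun j hj => Function.update_of_ne hj ..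
  -- On this event the deviator is the only top box, and its reservation value is positive while all
  -- other values are `0`, so it is selected with certainty.
  set B : Fin n → Set ℝ := fun j => if j = i then {μ} else {0} with hB
  have hBm : MeasurableSet (Set.univ.pi B) := MeasurableSet.univ_pi fun j => by
    simp only [hB]; split_ifs <;> exact measurableSet_singleton _
  have hval : (jointLaw σ).real (Set.univ.pi B) = (1 - μ) ^ (n - 1) := by
    rw [measureReal_def, Measure.pi_pi, ENNReal.toReal_prod,
      ← Finset.mul_prod_erase _ _ (Finset.mem_univ i)]
    have e1 : ((σ i).law (B i)).toReal = 1 := by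
      simp [hσi, hB, hU, uninformative]
    have e2 : ∀ j ∈ Finset.univ.erase i, ((σ j).law (B j)).toReal = 1 - μ := by
      intro j hj
      have hji := Finset.ne_of_mem_erase hj
      simp [hσj j hji, hB, hji, hF, fullyRevealing, h1]
    rw [e1, one_mul, Finset.prod_congr rfl e2, Finset.prod_const,
      Finset.card_erase_of_mem (Finset.mem_univ i), Finset.card_univ, Fintype.card_fin]
  have hle : ∀ᵐ x ∂(jointLaw σ), (Set.univ.pi B).indicator 1 x ≤ p.selectFrom i x n [] := by
    filter_upwards [hopt.ae_regular hn hβ0 hβ1 hc hs hf] with x hreg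
    by_cases hx : x ∈ Set.univ.pi B
    · rw [indicator_of_mem hx]
      have hxi : x i = μ := by simpa [hB] using hx i trivial
      have hxj : ∀ j, j ≠ i → x j = 0 := fun j hj => by simpa [hB, hj] using hx j trivial
      have htop : IsTop x i := fun j => by
        by_cases hj : j = i
        · rw [hj]
        · rw [hxj j hj, hxi]; exact h0.le
      have hcount : topCount x = 1 := by
        classical
        unfold topCount
        rw [Finset.sum_eq_single i]
        · simp [htop]
        · intro j _ hj
          refine if_neg fun h => ?_
          have := h i
          rw [hxj j hj, hxi] at this
          linarith
        · simp
      have := hreg.le_selectFrom hfair (by rw [hxi]; exact h0.le) htop (fun j hj => by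
        rw [hxj j hj]; exact reservationValue_pos hβ0 hβ1 hc hs hf _) n [] List.nodup_nil
        zero_lt_one (by simp)
      rw [hcount, inv_one] at this
      exact this
    · rw [indicator_of_notMem hx]
      exact p.selectFrom_nonneg _ _ _
  rw [← hval, ← integral_indicator_one hBm]
  exact integral_mono_ae ((integrable_const (1 : ℝ)).indicator hBm)
    (p.integrable_selectFrom _ i n []) hle

/-- If the reservation value of `F` is not maximal, it increases when `F` is mixed with the fully
revealing signal. -/
theorem reservationValue_lt_mixRevealing (hβ0 : 0 < β) (hβ1 : β ≤ 1) (hc : 0 ≤ c)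
    (hs : c < β * μ) (hf : 0 < c ∨ β < 1) (h0 : 0 ≤ μ) (h1 : μ ≤ 1) {F H : Strategy μ}
    (hH : reservationValue c β F < reservationValue c β H) {t : ℝ} (ht0 : 0 < t) (ht1 : t ≤ 1) :
    reservationValue c β F < reservationValue c β (F.mixRevealing h0 h1 t ht0.le ht1) := by
  have hF := reservationValue_spec hβ0 hβ1 hc hs hf F
  set r := reservationValue c β F
  -- At the sure value `r`, opening `H` has a positive net gain, and full revelation gains at least
  -- as much by convexity. Opening `F` gains exactly `0`, so any mixture with positive weight on
  -- full revelation gains.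
  have hHr : r < -c + β * ∫ x, max r x ∂H.law := by
    by_contra! hle
    rcases hle.lt_or_eq with h | h
    · exact absurd (reservationValue_lt hβ0 hβ1 hc hs hf H h) (not_lt.2 hH.le)
    · exact hH.ne ((existsUnique_isReservationValue hβ0 hβ1 hc hs hf H).unique h.symm
        (reservationValue_spec hβ0 hβ1 hc hs hf H))
  have hfull := H.integral_le_fullyRevealing h0 h1 (convexOn_max_const r)
  refine lt_reservationValue hβ0 hβ1 hc hs hf _ ?_
  rw [F.integral_mixRevealing h0 h1 t ht0.le ht1 (f := fun x => max r x) (by fun_prop)]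
  have h2 : β * ∫ x, max r x ∂F.law < β * ∫ x, max r x ∂(fullyRevealing μ h0 h1).law := by
    have := mul_le_mul_of_nonneg_left hfull hβ0.le
    linarith
  nlinarith [mul_pos ht0 (sub_pos.2 h2)]

/-- A slightly more informative signal is a profitable deviation. -/
theorem exists_profitable_spread (hn : 2 ≤ n) (hβ0 : 0 < β) (hβ1 : β ≤ 1) (hc : 0 ≤ c)
    (hs : c < β * μ) (hf : 0 < c ∨ β < 1) (h0 : 0 ≤ μ) (h1 : μ ≤ 1)
    {η : (Fin n → Strategy μ) → Policy n} (hη : IsFairOptimalResponse c β η)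
    {F H : Strategy μ} (hH : reservationValue c β F < reservationValue c β H) {ε : ℝ}
    (hε : 0 < ε) :
    ∃ G : Strategy μ, MoreInformative G F ∧
      (∀ A, MeasurableSet A → |G.law.real A - F.law.real A| < ε) ∧
      reservationValue c β F < reservationValue c β G ∧
      reservationValue c β G < reservationValue c β F + ε ∧
      (∀ i, 1 / (n : ℝ) < boxPayoff (Function.update (fun _ => F) i G)
        (η (Function.update (fun _ => F) i G)) i) ∧
      ∃ i, boxPayoff (fun _ => F) (η (fun _ => F)) i <
        boxPayoff (Function.update (fun _ => F) i G)
          (η (Function.update (fun _ => F) i G)) i := by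
  set r := reservationValue c β F with hr
  set a := F.law.real (Ioi r) with ha
  have ha0 : 0 < a := ENNReal.toReal_pos
    (measure_Ioi_reservationValue_pos hβ0 hβ1 hc hs hf F).ne' (measure_ne_top _ _)
  have hgain := add_pow_div_gt ha0 measureReal_le_one hn
  have hneg := gain_neg hβ0 hβ1 hc hs hf F (z := r + ε) (by linarith)
  -- Apart from `0 < t`, the requirements are open conditions that hold at `t = 0`. They secure, in
  -- turn, the payoff, the upper bound on the new reservation value, a valid weight and closeness of
  -- the laws.
  obtain ⟨t, ⟨⟨hP, hz⟩, ht1, htε⟩, ht0⟩ : ∃ t : ℝ,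
      ((1 / (n : ℝ) < (1 - t) * (a + (1 - a) ^ n / n) ∧
        -c + β * ((1 - t) * (∫ x, max (r + ε) x ∂F.law)
          + t * ∫ x, max (r + ε) x ∂(fullyRevealing μ h0 h1).law) < r + ε) ∧ t < 1 ∧ t < ε)
      ∧ t ∈ Ioi (0 : ℝ) := by
    have c1 : ∀ᶠ t : ℝ in nhds 0, 1 / (n : ℝ) < (1 - t) * (a + (1 - a) ^ n / n) :=
      (Continuous.tendsto (by fun_prop) 0).eventually_const_lt (by simpa using hgain)
    have c2 : ∀ᶠ t : ℝ in nhds 0, -c + β * ((1 - t) * (∫ x, max (r + ε) x ∂F.law)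
        + t * ∫ x, max (r + ε) x ∂(fullyRevealing μ h0 h1).law) < r + ε :=
      (Continuous.tendsto (by fun_prop) 0).eventually_lt_const (by simpa using hneg)
    have h := ((c1.and c2).and ((gt_mem_nhds zero_lt_one).and (gt_mem_nhds hε)))
    have hpos : ∀ᶠ t : ℝ in nhdsWithin 0 (Ioi 0), t ∈ Ioi (0 : ℝ) := self_mem_nhdsWithin
    exact ((h.filter_mono nhdsWithin_le_nhds).and hpos).exists
  set G := F.mixRevealing h0 h1 t (le_of_lt ht0) ht1.le with hG
  have hlt : r < reservationValue c β G :=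
    reservationValue_lt_mixRevealing hβ0 hβ1 hc hs hf h0 h1 hH ht0 ht1.le
  have hpay : ∀ i, 1 / (n : ℝ) < boxPayoff (Function.update (fun _ => F) i G)
      (η (Function.update (fun _ => F) i G)) i := fun i =>
    hP.trans_le (le_boxPayoff_update hn hβ0 hβ1 hc hs hf hlt (hη _).1 (hη _).2
      (fullyRevealing μ h0 h1).law (le_of_lt ht0) ht1.le rfl)
  refine ⟨G, F.moreInformative_mixRevealing h0 h1 t _ _,
    fun A _ => (F.abs_mixRevealing_sub_le h0 h1 t _ _ A).trans_lt htε, hlt,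
    reservationValue_lt hβ0 hβ1 hc hs hf G ?_, hpay, ?_⟩
  · rw [F.integral_mixRevealing h0 h1 t _ _ (f := fun x => max (r + ε) x) (by fun_prop)]
    exact hz
  -- No symmetry of the payoffs under the common `F` is used, only that their sum is at most `1`.
  · obtain ⟨i, hi⟩ := exists_boxPayoff_le (by omega) (fun _ => F) (η (fun _ => F))
    exact ⟨i, hi.trans_lt (hpay i)⟩

/-- Raising to the power `n - 1` undoes the root in the hypothesis. -/
theorem one_div_lt_pow (hn : 2 ≤ n) (hμ : μ < 1 - (1 / (n : ℝ)) ^ (1 / ((n : ℝ) - 1))) :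
    1 / (n : ℝ) < (1 - μ) ^ (n - 1) := by
  have hn' : (0 : ℝ) ≤ 1 / (n : ℝ) := by positivity
  have h := pow_lt_pow_left₀ (show (1 / (n : ℝ)) ^ (1 / ((n : ℝ) - 1)) < 1 - μ by linarith)
    (Real.rpow_nonneg hn' _) (show n - 1 ≠ 0 by omega)
  have e : ((n - 1 : ℕ) : ℝ) = (n : ℝ) - 1 := by
    rw [Nat.cast_sub (by omega), Nat.cast_one]
  rw [← e, one_div ((n - 1 : ℕ) : ℝ), Real.rpow_inv_natCast_pow hn' (by omega)] at h
  exact h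

/-- Uninformative signals are a profitable deviation from full revelation. -/
theorem boxPayoff_fullyRevealing_lt (hn : 2 ≤ n) (hβ0 : 0 < β) (hβ1 : β ≤ 1) (hc : 0 ≤ c)
    (hs : c < β * μ) (hf : 0 < c ∨ β < 1) (h0 : 0 < μ) (h1 : μ ≤ 1)
    (hμ : μ < 1 - (1 / (n : ℝ)) ^ (1 / ((n : ℝ) - 1)))
    {η : (Fin n → Strategy μ) → Policy n} (hη : IsFairOptimalResponse c β η)
    {F U : Strategy μ} (hF : F = fullyRevealing μ h0.le h1) (hU : U = uninformative μ h0.le h1)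
    (i : Fin n) : boxPayoff (fun _ => F) (η (fun _ => F)) i <
      boxPayoff (Function.update (fun _ => F) i U) (η (Function.update (fun _ => F) i U)) i := by
  have hle : boxPayoff (fun _ => F) (η (fun _ => F)) i ≤ 1 / n := by
    subst hF
    exact boxPayoff_fullyRevealing_le (by omega) hβ0 hβ1 hc hs hf h0.le h1 (hη _).1 (hη _).2 i
  exact hle.trans_lt ((one_div_lt_pow hn hμ).trans_le (pow_le_boxPayoff_uninformative (by omega)
    hβ0 hβ1 hc hs hf h0 h1 hF hU (hη _).1 (hη _).2))

end Payoffs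

end PandoraGame

/-! ### The main theorem -/

open PandoraGame
theorem theorem7 (n : ℕ) (hn : 2 ≤ n) (μ c β : ℝ) (hμ0 : 0 < μ) (hμ1 : μ < 1)
    (hc : 0 ≤ c) (hβ0 : 0 < β) (hβ1 : β ≤ 1) (hsearch : c < β * μ)
    (hfriction : 0 < c ∨ β < 1)
    (hμ : μ < 1 - (1 / (n : ℝ)) ^ (1 / ((n : ℝ) - 1))) :
    (¬ ∃ (η : (Fin n → Strategy μ) → Policy n) (F : Strategy μ), IsFSPE c β η (fun _ => F)) ∧
    ∀ η : (Fin n → Strategy μ) → Policy n, IsFairOptimalResponse c β η →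
      (∀ F : Strategy μ, (∃ H : Strategy μ, reservationValue c β F < reservationValue c β H) →
        ∀ ε > 0, ∃ G : Strategy μ,
          MoreInformative G F ∧
          (∀ A, MeasurableSet A → |G.law.real A - F.law.real A| < ε) ∧
          reservationValue c β F < reservationValue c β G ∧
          reservationValue c β G < reservationValue c β F + ε ∧
          (∀ i, 1 / (n : ℝ) < boxPayoff (Function.update (fun _ => F) i G)
            (η (Function.update (fun _ => F) i G)) i) ∧
          ∃ i, boxPayoff (fun _ => F) (η (fun _ => F)) i <
            boxPayoff (Function.update (fun _ => F) i G)
              (η (Function.update (fun _ => F) i G)) i) ∧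
      (∀ G₀ U : Strategy μ, G₀ = fullyRevealing μ hμ0.le hμ1.le →
        U = uninformative μ hμ0.le hμ1.le → ∀ i,
        boxPayoff (fun _ => G₀) (η (fun _ => G₀)) i <
          boxPayoff (Function.update (fun _ => G₀) i U)
            (η (Function.update (fun _ => G₀) i U)) i) := by
  refine ⟨?_, fun η hη => ⟨fun F ⟨H, hH⟩ ε hε => exists_profitable_spread hn hβ0 hβ1 hc hsearch
    hfriction hμ0.le hμ1.le hη hH hε, fun G₀ U hG₀ hU i => boxPayoff_fullyRevealing_lt hn hβ0 hβ1
    hc hsearch hfriction hμ0 hμ1.le hμ hη hG₀ hU i⟩⟩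
  rintro ⟨η, F, hη, hdev⟩
  by_cases hmax : ∃ H : Strategy μ, reservationValue c β F < reservationValue c β H
  · obtain ⟨H, hH⟩ := hmax
    obtain ⟨G, -, -, -, -, -, i, hi⟩ := exists_profitable_spread hn hβ0 hβ1 hc hsearch hfriction
      hμ0.le hμ1.le hη hH one_pos
    exact absurd (hdev i G) (not_le.2 hi)
  -- If full revelation had a larger expectation of `max z_F x`, its reservation value would exceed
  -- `z_F`, against maximality; so `F` attains the maximum of this expectation, which only full
  -- revelation does.
  · have hF : F = fullyRevealing μ hμ0.le hμ1.le := by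
      refine F.eq_fullyRevealing hμ0.le hμ1.le
        (reservationValue_pos hβ0 hβ1 hc hsearch hfriction F)
        (reservationValue_lt_one hβ0 hβ1 hc hsearch hfriction F) ?_
      by_contra! hlt
      refine hmax ⟨fullyRevealing μ hμ0.le hμ1.le,
        lt_reservationValue hβ0 hβ1 hc hsearch hfriction _ ?_⟩
      have := reservationValue_spec hβ0 hβ1 hc hsearch hfriction F
      nlinarith [mul_lt_mul_of_pos_left hlt hβ0]
    exact absurd (hdev ⟨0, by omega⟩ (uninformative μ hμ0.le hμ1.le))
      (not_le.2 (boxPayoff_fullyRevealing_lt hn hβ0 hβ1 hc hsearch hfriction hμ0 hμ1.le hμ hη hF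
        rfl _))
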